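/- Let $p$ be a prime, let $r \ge 1$, and let $G = H_1 \times \dots \times H_r$ be a direct product of (topologically) finitely generated pro-$p$ groups $H_j$ of positive rank gradient, where the rank gradient of a finitely generated pro-$p$ group $H$ is $$\mathrm{RG}(H) = \inf_{U \le_{\mathrm o} H} \frac{d(U)-1}{|H:U|},$$ the infimum being taken over all open subgroups $U$ of $H$, and $d(U)$ denoting the minimal number of topological generators of $U$. Let $\mathcal F$ be the Frattini series of $G$, given by $\Phi_0(G)=G$ and $\Phi_{i+1}(G) = \overline{[\Phi_i(G),\Phi_i(G)]\,\Phi_i(G)^p}$ for $i \ge 0$, and equip $G$ with the metric $$d_{\mathcal F}(x,y) = \inf\{\, |G:\Phi_i(G)|^{-1} : i \ge 0,\ x^{-1}y \in \Phi_i(G) \,\}.$$ For a closed subgroup $K$ of $G$ let $\mathrm{hdim}_G^{\mathcal F}(K)$ be the Hausdorff dimension of $K$ with respect to $d_{\mathcal F}$, and put $\alpha_j = \mathrm{hdim}_G^{\mathcal F}(H_j)$ for $1 \le j \le r$, where $H_j$ is regarded as the $j$-th direct factor of $G$. Then the normal Hausdorff spectrum of $G$ with respect to $\mathcal F$ is $$\{\,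 \mathrm{hdim}_G^{\mathcal F}(N) : N \text{ a closed normal subgroup of } G \,\} = \Bigl\{\, \sum_{j \in J} \alpha_j : J \subseteq \{1,\dots,r\} \,\Bigr\}.$$ -/

import Mathlib

open scoped ENNReal commutatorElement

namespace ProP

section Basic

/-- `G` is a pro-`p` group: a compact, Hausdorff, totally disconnected topological group
all of whose open normal subgroups have index a power of `p`. -/
structure IsProP (p : ℕ) (G : Type*) [Group G] [TopologicalSpace G] : Prop where
  isTopologicalGroup : IsTopologicalGroup G
  compact : CompactSpace G
  t2 : T2Space G
  totallyDisconnected : TotallyDisconnectedSpace G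
  index_eq_pow : ∀ N : Subgroup G, N.Normal → IsOpen (N : Set G) → ∃ n : ℕ, N.index = p ^ n

/-- The set `S` generates the topological group `G` topologically: the abstract subgroup
generated by `S` is dense. -/
def TopGenerates {G : Type*} [Group G] [TopologicalSpace G] (S : Set G) : Prop :=
  Dense (Subgroup.closure S : Set G)

/-- `G` is (topologically) finitely generated. -/
def IsTopFG (G : Type*) [Group G] [TopologicalSpace G] : Prop :=
  ∃ S : Finset G, TopGenerates (S : Set G)

/-- `d(G)`: the minimal number of topological generators of `G`
(only meaningful for finitely generated `G`). -/
noncomputable def topRank (G : Type*) [Group G] [TopologicalSpace G] : ℕ :=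
  sInf {n | ∃ S : Finset G, S.card = n ∧ TopGenerates (S : Set G)}

/-- The (absolute) rank gradient of a finitely generated pro-`p` group: the infimum of
`(d(U) - 1) / |G : U|` over all open subgroups `U` of `G`. -/
noncomputable def rankGradient (G : Type*) [Group G] [TopologicalSpace G] : ℝ :=
  ⨅ U : OpenSubgroup G,
    ((topRank (U : Subgroup G) : ℝ) - 1) / ((U : Subgroup G).index : ℝ)

end Basic

section Hausdorff

variable {G : Type*} [Group G] [TopologicalSpace G]

/-- A filtration (series) of `G`: a descending chain of open normal subgroups `G_i`,
`i = 0, 1, 2, …`, that intersect in the identity. -/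
structure Filtration (G : Type*) [Group G] [TopologicalSpace G] where
  /-- the terms of the series -/
  toFun : ℕ → Subgroup G
  antitone : Antitone toFun
  normal : ∀ i, (toFun i).Normal
  isOpen : ∀ i, IsOpen (toFun i : Set G)
  iInf_eq_bot : ⨅ i, toFun i = ⊥

open Classical in
/-- The distance on `G` induced by a filtration: the infimum of all `|G : G_i|⁻¹` with
`x⁻¹ y ∈ G_i`. For infinite `G` the infimum is `0` when `x = y`; putting it to `0` there in
every case also gives a metric on a finite group. -/
noncomputable def Filtration.edist (S : Filtration G) (x y : G) : ℝ≥0∞ :=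
  if x = y then 0 else
    ⨅ (i : ℕ) (_ : x⁻¹ * y ∈ S.toFun i), ((S.toFun i).index : ℝ≥0∞)⁻¹

theorem Filtration.edist_comm (S : Filtration G) (x y : G) : S.edist x y = S.edist y x := by
  have h : ∀ i, x⁻¹ * y ∈ S.toFun i ↔ y⁻¹ * x ∈ S.toFun i := fun i => by
    rw [← inv_mem_iff, mul_inv_rev, inv_inv]
  by_cases hxy : x = y
  · rw [hxy]
  · simp only [Filtration.edist, h, if_neg hxy, if_neg (Ne.symm hxy)]

theorem Filtration.edist_triangle (S : Filtration G) (x y z : G) :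
    S.edist x z ≤ S.edist x y + S.edist y z := by
  by_cases hxz : x = z
  · simp [Filtration.edist, hxz]
  by_cases hxy : x = y
  · rw [hxy]; exact le_add_self
  by_cases hyz : y = z
  · rw [hyz]; exact le_self_add
  simp only [Filtration.edist, hxz, hxy, hyz, if_false]
  have key : ∀ i, x⁻¹ * y ∈ S.toFun i → ∀ j, y⁻¹ * z ∈ S.toFun j →
      (⨅ (i : ℕ) (_ : x⁻¹ * z ∈ S.toFun i), ((S.toFun i).index : ℝ≥0∞)⁻¹) ≤
        ((S.toFun i).index : ℝ≥0∞)⁻¹ + ((S.toFun j).index : ℝ≥0∞)⁻¹ := by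
    intro i hi j hj
    have hm : x⁻¹ * z ∈ S.toFun (min i j) := by
      have h1 := S.antitone (min_le_left i j) hi
      have h2 := S.antitone (min_le_right i j) hj
      simpa [mul_assoc] using mul_mem h1 h2
    refine (iInf₂_le (min i j) hm).trans ?_
    rcases min_choice i j with h | h <;> rw [h]
    · exact le_self_add
    · exact le_add_self
  refine ENNReal.le_of_forall_pos_le_add fun ε hε hfin => ?_
  have hε' : (ε / 2 : ℝ≥0∞) ≠ 0 := by simp [hε.ne']
  have hA := (ENNReal.add_ne_top.1 hfin.ne).1
  have hB := (ENNReal.add_ne_top.1 hfin.ne).2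
  have h1 := ENNReal.lt_add_right hA hε'
  have h2 := ENNReal.lt_add_right hB hε'
  simp only [iInf_lt_iff] at h1 h2
  obtain ⟨i, hi, h1⟩ := h1
  obtain ⟨j, hj, h2⟩ := h2
  refine (key i hi j hj).trans ((add_le_add h1.le h2.le).trans (le_of_eq ?_))
  rw [add_add_add_comm, ENNReal.add_halves]

theorem Filtration.eq_of_edist_eq_zero (S : Filtration G) {x y : G} (h : S.edist x y = 0) :
    x = y := by
  by_contra hxy
  have hne : x⁻¹ * y ∉ (⨅ i, S.toFun i) := by
    rw [S.iInf_eq_bot, Subgroup.mem_bot, inv_mul_eq_one]; exact hxy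
  obtain ⟨n, hn⟩ : ∃ n, x⁻¹ * y ∉ S.toFun n := by
    simpa [Subgroup.mem_iInf] using hne
  have hfin : ∃ c : ℝ≥0∞, c ≠ 0 ∧ ∀ i ∈ Finset.range n, c ≤ ((S.toFun i).index : ℝ≥0∞)⁻¹ := by
    refine ⟨(Finset.range n).inf fun i => ((S.toFun i).index : ℝ≥0∞)⁻¹, ?_,
      fun i hi => Finset.inf_le hi⟩
    rw [← pos_iff_ne_zero, Finset.lt_inf_iff (by simp)]
    intro i _
    simp
  obtain ⟨c, hc, hle⟩ := hfin
  refine hc (le_antisymm ?_ (by simp))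
  rw [← h, Filtration.edist, if_neg hxy]
  refine le_iInf₂ fun i hi => hle i ?_
  rw [Finset.mem_range]
  by_contra hni
  exact hn (S.antitone (not_lt.1 hni) hi)

/-- The metric space structure on `G` given by a filtration. -/
@[reducible] noncomputable def Filtration.emetricSpace (S : Filtration G) : EMetricSpace G where
  edist := S.edist
  edist_self x := by simp [Filtration.edist]
  edist_comm := S.edist_comm
  edist_triangle := S.edist_triangle
  eq_of_edist_eq_zero := S.eq_of_edist_eq_zero

/-- The Hausdorff dimension of a subgroup `H` of `G`, as a subset of the metric space `G`
whose metric comes from the filtration `S`. -/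
noncomputable def hdim (S : Filtration G) (H : Subgroup G) : ℝ≥0∞ :=
  @dimH G S.emetricSpace (H : Set G)

/-- The normal Hausdorff spectrum: the set of Hausdorff dimensions of all closed normal
subgroups. -/
def normalHausdorffSpectrum (S : Filtration G) : Set ℝ≥0∞ :=
  {d | ∃ N : Subgroup G, N.Normal ∧ IsClosed (N : Set G) ∧ hdim S N = d}

end Hausdorff

section Frattini

variable {G : Type*} [Group G] [TopologicalSpace G]

/-- `[K, K] K^p`, taken topologically: the closure of the subgroup generated by all
commutators and all `p`-th powers of elements of `K`. -/
def frattiniStep (p : ℕ) [IsTopologicalGroup G] (K : Subgroup G) : Subgroup G :=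
  (⁅K, K⁆ ⊔ Subgroup.closure {y | ∃ x ∈ K, y = x ^ p}).topologicalClosure

/-- The Frattini series `Φ_0(G) = G`, `Φ_{i+1}(G) = [Φ_i(G), Φ_i(G)] Φ_i(G)^p`. -/
def frattiniSeries (p : ℕ) (G : Type*) [Group G] [TopologicalSpace G] [IsTopologicalGroup G] :
    ℕ → Subgroup G
  | 0 => ⊤
  | i + 1 => frattiniStep p (frattiniSeries p G i)

variable [IsTopologicalGroup G]

theorem commutator_mem_frattiniStep (p : ℕ) {K : Subgroup G} {x y : G} (hx : x ∈ K)
    (hy : y ∈ K) : ⁅x, y⁆ ∈ frattiniStep p K :=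
  Subgroup.le_topologicalClosure _ (Subgroup.mem_sup_left (Subgroup.commutator_mem_commutator hx hy))

theorem pow_mem_frattiniStep (p : ℕ) {K : Subgroup G} {x : G} (hx : x ∈ K) :
    x ^ p ∈ frattiniStep p K :=
  Subgroup.le_topologicalClosure _
    (Subgroup.mem_sup_right (Subgroup.subset_closure ⟨x, hx, rfl⟩))

theorem frattiniStep_le (p : ℕ) {K L : Subgroup G} (hL : IsClosed (L : Set G))
    (h1 : ∀ x ∈ K, ∀ y ∈ K, ⁅x, y⁆ ∈ L) (h2 : ∀ x ∈ K, x ^ p ∈ L) : frattiniStep p K ≤ L := by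
  refine Subgroup.topologicalClosure_minimal _ (sup_le (Subgroup.commutator_le.2 h1) ?_) hL
  rw [Subgroup.closure_le]
  rintro _ ⟨x, hx, rfl⟩
  exact h2 x hx

theorem isClosed_frattiniStep (p : ℕ) (K : Subgroup G) :
    IsClosed (frattiniStep p K : Set G) := Subgroup.isClosed_topologicalClosure _

theorem isClosed_frattiniSeries (p : ℕ) (i : ℕ) : IsClosed (frattiniSeries p G i : Set G) := by
  cases i with
  | zero => exact isClosed_univ
  | succ i => exact isClosed_frattiniStep p _

theorem frattiniSeries_antitone (p : ℕ) : Antitone (frattiniSeries p G) := by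
  refine antitone_nat_of_succ_le fun i => frattiniStep_le p (isClosed_frattiniSeries p i) ?_ ?_
  · intro x hx y hy
    exact mul_mem (mul_mem (mul_mem hx hy) (inv_mem hx)) (inv_mem hy)
  · intro x hx
    exact pow_mem hx p

theorem frattiniStep_normal (p : ℕ) (K : Subgroup G) (hK : K.Normal) :
    (frattiniStep p K).Normal := by
  have h2 : (Subgroup.closure {y | ∃ x ∈ K, y = x ^ p}).Normal := by
    refine ⟨fun n hn g => ?_⟩
    induction hn using Subgroup.closure_induction with
    | mem y hy =>
      obtain ⟨x, hx, rfl⟩ := hy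
      exact Subgroup.subset_closure ⟨g * x * g⁻¹, hK.conj_mem x hx g, (conj_pow).symm⟩
    | one => simp
    | mul a b _ _ ha hb => simpa [mul_assoc] using mul_mem ha hb
    | inv a _ ha => simpa [mul_assoc] using inv_mem ha
  have : (⁅K, K⁆ ⊔ Subgroup.closure {y | ∃ x ∈ K, y = x ^ p}).Normal := inferInstance
  exact Subgroup.is_normal_topologicalClosure _

theorem frattiniSeries_normal (p : ℕ) (i : ℕ) : (frattiniSeries p G i).Normal := by
  induction i with
  | zero => exact Subgroup.normal_top
  | succ i ih => exact frattiniStep_normal p _ ih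

/-- In a finite `p`-group, a nontrivial subgroup `H` has a proper subgroup containing all
commutators and `p`-th powers of elements of `H`. -/
theorem exists_lt_of_isPGroup (p : ℕ) [Fact p.Prime] {Q : Type*} [Group Q] [Finite Q]
    (hQ : IsPGroup p Q) (H : Subgroup Q) (hH : H ≠ ⊥) :
    ∃ L : Subgroup Q, L < H ∧ (∀ x ∈ H, ∀ y ∈ H, ⁅x, y⁆ ∈ L) ∧ ∀ x ∈ H, x ^ p ∈ L := by
  have hp : p.Prime := Fact.out
  obtain ⟨n, hn⟩ := IsPGroup.iff_card.1 (hQ.to_subgroup H)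
  have hn0 : n ≠ 0 := by
    rintro rfl
    exact hH (Subgroup.card_eq_one.1 (by simpa using hn))
  obtain ⟨m, rfl⟩ := Nat.exists_eq_succ_of_ne_zero hn0
  obtain ⟨M, hM⟩ := Sylow.exists_subgroup_card_pow_prime (G := H) p (n := m)
    (by rw [hn]; exact pow_dvd_pow p (Nat.le_succ m))
  have hidx : M.index = p := by
    have := M.card_mul_index
    rw [hM, hn, pow_succ] at this
    exact Nat.eq_of_mul_eq_mul_left (pow_pos hp.pos m) this
  have hMn : M.Normal := by
    refine Subgroup.normal_of_index_eq_minFac_card ?_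
    rw [hidx, hn, Nat.pow_minFac hn0, hp.minFac_eq]
  have hcard : Nat.card (H ⧸ M) = p := by rw [← hidx]; rfl
  have hcyc : IsCyclic (H ⧸ M) := isCyclic_of_prime_card hcard
  have hcomm : ∀ a b : H ⧸ M, a * b = b * a := fun a b => by
    let := IsCyclic.commGroup (α := H ⧸ M)
    exact mul_comm a b
  refine ⟨M.map H.subtype, ?_, ?_, ?_⟩
  · refine lt_of_le_of_ne (Subgroup.map_subtype_le M) fun h => ?_
    have : M = ⊤ := by
      rw [eq_top_iff]
      intro x _
      have hx : (x : Q) ∈ M.map H.subtype := by rw [h]; exact x.2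
      obtain ⟨y, hy, hxy⟩ := hx
      rwa [← Subtype.ext hxy]
    rw [this, Subgroup.index_top] at hidx
    exact hp.one_lt.ne hidx
  · intro x hx y hy
    refine ⟨⁅(⟨x, hx⟩ : H), ⟨y, hy⟩⁆, ?_, rfl⟩
    have : ((⁅(⟨x, hx⟩ : H), ⟨y, hy⟩⁆ : H) : H ⧸ M) = 1 := by
      have := map_commutatorElement (QuotientGroup.mk' M) (⟨x, hx⟩ : H) ⟨y, hy⟩
      simp only [QuotientGroup.mk'_apply] at this
      rw [this, commutatorElement_eq_one_iff_mul_comm]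
      exact hcomm _ _
    exact (QuotientGroup.eq_one_iff _).1 this
  · intro x hx
    refine ⟨(⟨x, hx⟩ : H) ^ p, ?_, rfl⟩
    have : (((⟨x, hx⟩ : H) ^ p : H) : H ⧸ M) = 1 := by
      rw [QuotientGroup.mk_pow, ← hcard, pow_card_eq_one']
    exact (QuotientGroup.eq_one_iff _).1 this

theorem exists_frattiniSeries_le (p : ℕ) [Fact p.Prime] (hG : IsProP p G) (V : Subgroup G)
    (hV : V.Normal) (hVo : IsOpen (V : Set G)) : ∃ n, frattiniSeries p G n ≤ V := by
  have := hG.compact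
  have : Finite (G ⧸ V) := Subgroup.quotient_finite_of_isOpen V hVo
  have hQ : IsPGroup p (G ⧸ V) := by
    obtain ⟨k, hk⟩ := hG.index_eq_pow V hV hVo
    exact IsPGroup.of_card (n := k) (by rw [← hk]; rfl)
  set f := QuotientGroup.mk' V with hf
  have key : ∀ n, (frattiniSeries p G n).map f = ⊥ ∨
      Nat.card ((frattiniSeries p G n).map f) + n ≤ Nat.card (G ⧸ V) := by
    intro n
    induction n with
    | zero =>
      right
      have := Subgroup.card_le_card_group ((frattiniSeries p G 0).map f)
      omega
    | succ n ih =>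
      by_cases hb : (frattiniSeries p G n).map f = ⊥
      · left
        rw [eq_bot_iff, ← hb]
        exact Subgroup.map_mono (frattiniSeries_antitone p (Nat.le_succ n))
      · right
        have ih := ih.resolve_left hb
        obtain ⟨L, hL, h1, h2⟩ := exists_lt_of_isPGroup p hQ _ hb
        have hLo : IsOpen (L.comap f : Set G) := by
          refine Subgroup.isOpen_mono (H₁ := V) ?_ hVo
          intro x hx
          have : f x = 1 := (QuotientGroup.eq_one_iff x).2 hx
          simp [Subgroup.mem_comap, this, L.one_mem]
        have hle : frattiniSeries p G (n + 1) ≤ L.comap f := by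
          refine frattiniStep_le p (Subgroup.isClosed_of_isOpen _ hLo) ?_ ?_
          · intro x hx y hy
            rw [Subgroup.mem_comap, map_commutatorElement]
            exact h1 _ (Subgroup.mem_map_of_mem f hx) _ (Subgroup.mem_map_of_mem f hy)
          · intro x hx
            rw [Subgroup.mem_comap, map_pow]
            exact h2 _ (Subgroup.mem_map_of_mem f hx)
        have hle' : (frattiniSeries p G (n + 1)).map f < (frattiniSeries p G n).map f :=
          lt_of_le_of_lt (Subgroup.map_le_iff_le_comap.2 hle) hL
        have := Set.Finite.card_lt_card (Set.toFinite _) (SetLike.coe_ssubset_coe.2 hle')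
        have h3 : Nat.card ((frattiniSeries p G (n + 1)).map f) <
          Nat.card ((frattiniSeries p G n).map f) := this
        omega
  refine ⟨Nat.card (G ⧸ V), ?_⟩
  have h := (key (Nat.card (G ⧸ V))).resolve_right (by
    have : 0 < Nat.card ((frattiniSeries p G (Nat.card (G ⧸ V))).map f) := Nat.card_pos
    omega)
  rw [Subgroup.map_eq_bot_iff, hf, QuotientGroup.ker_mk'] at h
  exact h

theorem iInf_frattiniSeries (p : ℕ) [Fact p.Prime] (hG : IsProP p G) :
    ⨅ i, frattiniSeries p G i = ⊥ := by
  have := hG.compact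
  have := hG.t2
  have := hG.totallyDisconnected
  rw [eq_bot_iff]
  intro x hx
  by_contra hx1
  obtain ⟨V, hV⟩ := ProfiniteGrp.exist_openNormalSubgroup_sub_open_nhds_of_one
    (G := G) (U := {x}ᶜ) isOpen_compl_singleton (fun h => hx1 (by simpa using h.symm))
  obtain ⟨n, hn⟩ := exists_frattiniSeries_le p hG V.toSubgroup V.isNormal' V.isOpen'
  exact hV (hn ((Subgroup.mem_iInf.1 hx) n)) rfl

/-- Open subgroups of a topologically finitely generated compact group are closures of
finitely generated abstract subgroups. -/
theorem IsTopFG.exists_of_isOpen [CompactSpace G] (hG : IsTopFG G) (U : Subgroup G)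
    (hU : IsOpen (U : Set G)) :
    ∃ D : Subgroup G, D ≤ U ∧ Group.FG D ∧ (U : Set G) ⊆ closure (D : Set G) := by
  obtain ⟨S, hS⟩ := hG
  set Γ := Subgroup.closure (S : Set G) with hΓ
  have : Group.FG Γ := (Group.fg_iff_subgroup_fg _).2 ⟨S, rfl⟩
  have : Finite (G ⧸ U) := Subgroup.quotient_finite_of_isOpen U hU
  have : U.FiniteIndex := Subgroup.finiteIndex_of_finite_quotient
  have : Group.FG (U.subgroupOf Γ) := inferInstance
  refine ⟨U ⊓ Γ, inf_le_left, ?_, ?_⟩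
  · have : (U.subgroupOf Γ).map Γ.subtype = U ⊓ Γ := Subgroup.subgroupOf_map_subtype U Γ
    rw [← this]
    exact Group.fg_of_surjective (Γ.subtype.subgroupMap_surjective (U.subgroupOf Γ))
  · exact Dense.open_subset_closure_inter hS hU

theorem isOpen_frattiniStep (p : ℕ) [Fact p.Prime] [CompactSpace G] (hG : IsTopFG G)
    (U : Subgroup G) (hUn : U.Normal) (hU : IsOpen (U : Set G)) :
    IsOpen (frattiniStep p U : Set G) := by
  obtain ⟨D, hDU, hD, hd⟩ := hG.exists_of_isOpen U hU
  set N := frattiniStep p U with hN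
  have hNn : N.Normal := frattiniStep_normal p U hUn
  -- the image of `D` in the quotient by `N` is finite
  have hfin : Finite (D.map (QuotientGroup.mk' N)) := by
    have hc : ∀ a b : D.map (QuotientGroup.mk' N), a * b = b * a := by
      rintro ⟨_, a, ha, rfl⟩ ⟨_, b, hb, rfl⟩
      refine Subtype.ext ?_
      change QuotientGroup.mk' N a * QuotientGroup.mk' N b =
        QuotientGroup.mk' N b * QuotientGroup.mk' N a
      rw [← commutatorElement_eq_one_iff_mul_comm, ← map_commutatorElement]
      exact (QuotientGroup.eq_one_iff _).2 (commutator_mem_frattiniStep p (hDU ha) (hDU hb))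
    let : CommGroup (D.map (QuotientGroup.mk' N)) := { mul_comm := hc }
    have : Group.FG (D.map (QuotientGroup.mk' N)) :=
      Group.fg_of_surjective ((QuotientGroup.mk' N).subgroupMap_surjective D)
    refine CommGroup.finite_of_fg_isMulTorsion (G := D.map (QuotientGroup.mk' N)) ?_
    rintro ⟨_, a, ha, rfl⟩
    refine isOfFinOrder_iff_pow_eq_one.2 ⟨p, (Fact.out : p.Prime).pos, Subtype.ext ?_⟩
    change (QuotientGroup.mk' N a) ^ p = 1
    rw [← map_pow]
    exact (QuotientGroup.eq_one_iff _).2 (pow_mem_frattiniStep p (hDU ha))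
  -- `D N` is closed, so it contains `U`
  have hNcl : IsClosed (N : Set G) := isClosed_frattiniStep p U
  have hpre : IsClosed ((D.map (QuotientGroup.mk' N)).comap (QuotientGroup.mk' N) : Set G) := by
    have : T1Space (G ⧸ N) := by
      have : IsClosed (N : Set G) := hNcl
      infer_instance
    exact (Set.toFinite ((D.map (QuotientGroup.mk' N) : Subgroup (G ⧸ N)) :
      Set (G ⧸ N))).isClosed.preimage QuotientGroup.continuous_mk
  have hsub : U ≤ (D.map (QuotientGroup.mk' N)).comap (QuotientGroup.mk' N) := fun x hx =>
    closure_minimal (s := (D : Set G)) (Subgroup.le_comap_map _ _) hpre (hd hx)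
  have hidx : N.FiniteIndex := by
    have : Finite (G ⧸ U) := Subgroup.quotient_finite_of_isOpen U hU
    have : U.FiniteIndex := Subgroup.finiteIndex_of_finite_quotient
    have hfin2 : Finite (U.map (QuotientGroup.mk' N)) :=
      Finite.of_injective (Subgroup.inclusion (Subgroup.map_le_iff_le_comap.2 hsub))
        (Subgroup.inclusion_injective _)
    have hrel : N.relIndex U ≠ 0 := by
      have := Subgroup.relIndex_ker U (QuotientGroup.mk' N)
      rw [QuotientGroup.ker_mk'] at this
      rw [this]
      exact Nat.card_pos.ne'
    have hle : N ≤ U := by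
      refine frattiniStep_le p (Subgroup.isClosed_of_isOpen _ hU) ?_ fun x hx => pow_mem hx p
      intro x hx y hy
      exact mul_mem (mul_mem (mul_mem hx hy) (inv_mem hx)) (inv_mem hy)
    refine ⟨?_⟩
    rw [← Subgroup.relIndex_mul_index hle]
    exact mul_ne_zero hrel Subgroup.FiniteIndex.index_ne_zero
  exact Subgroup.isOpen_of_isClosed_of_finiteIndex N hNcl

theorem isOpen_frattiniSeries (p : ℕ) [Fact p.Prime] [CompactSpace G] (hG : IsTopFG G)
    (i : ℕ) : IsOpen (frattiniSeries p G i : Set G) := by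
  induction i with
  | zero => exact isOpen_univ
  | succ i ih => exact isOpen_frattiniStep p hG _ (frattiniSeries_normal p i) ih

end Frattini

/-- The Frattini series of a finitely generated pro-`p` group, as a filtration. -/
def frattiniFiltration (p : ℕ) [Fact p.Prime] {G : Type*} [Group G] [TopologicalSpace G]
    (hG : IsProP p G) (hfg : IsTopFG G) : Filtration G :=
  haveI := hG.isTopologicalGroup
  { toFun := frattiniSeries p G
    antitone := frattiniSeries_antitone p
    normal := frattiniSeries_normal p
    isOpen := by
      have := hG.compact
      exact isOpen_frattiniSeries p hfg
    iInf_eq_bot := iInf_frattiniSeries p hG }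

section Product

variable {ι : Type*} {H : ι → Type*} [∀ j, Group (H j)] [∀ j, TopologicalSpace (H j)]

/-- Products of pro-`p` groups are pro-`p`. -/
theorem IsProP.pi (p : ℕ) [Fact p.Prime] (hH : ∀ j, IsProP p (H j)) :
    IsProP p (∀ j, H j) := by
  have := fun j => (hH j).isTopologicalGroup
  have := fun j => (hH j).compact
  have := fun j => (hH j).t2
  have := fun j => (hH j).totallyDisconnected
  refine ⟨inferInstance, inferInstance, inferInstance, inferInstance, fun N hN hNo => ?_⟩
  have htend : ∀ g : ∀ j, H j, Filter.Tendsto (fun n : ℕ => g ^ p ^ n) Filter.atTop (nhds 1) := by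
    intro g
    rw [tendsto_pi_nhds]
    intro j
    rw [Filter.tendsto_def]
    intro s hs
    obtain ⟨t, hts, hto, h1⟩ := mem_nhds_iff.1 hs
    obtain ⟨V, hV⟩ := ProfiniteGrp.exist_openNormalSubgroup_sub_open_nhds_of_one hto h1
    have : V.toSubgroup.Normal := V.isNormal'
    obtain ⟨k, hk⟩ := (hH j).index_eq_pow V.toSubgroup V.isNormal' V.isOpen'
    refine Filter.mem_atTop_sets.2 ⟨k, fun n hn => hts (hV ?_)⟩
    have hmem : (g j) ^ p ^ k ∈ V.toSubgroup := hk ▸ Subgroup.pow_index_mem _ (g j)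
    obtain ⟨c, rfl⟩ := Nat.exists_eq_add_of_le hn
    change (g j) ^ p ^ (k + c) ∈ V.toSubgroup
    rw [pow_add, pow_mul]
    exact pow_mem hmem _
  have : Finite ((∀ j, H j) ⧸ N) := Subgroup.quotient_finite_of_isOpen N hNo
  have hP : IsPGroup p ((∀ j, H j) ⧸ N) := by
    intro a
    obtain ⟨g, rfl⟩ := QuotientGroup.mk_surjective a
    obtain ⟨n, hn⟩ := ((htend g).eventually (hNo.mem_nhds N.one_mem)).exists
    exact ⟨n, by rw [← QuotientGroup.mk_pow]; exact (QuotientGroup.eq_one_iff _).2 hn⟩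
  exact IsPGroup.iff_card.1 hP

/-- Finite products of topologically finitely generated groups are topologically finitely
generated. -/
theorem IsTopFG.pi [Finite ι] (hH : ∀ j, IsTopFG (H j)) : IsTopFG (∀ j, H j) := by
  classical
  have := Fintype.ofFinite ι
  choose S hS using hH
  refine ⟨Finset.univ.biUnion fun j => (S j).image (MonoidHom.mulSingle H j), ?_⟩
  set D := Subgroup.closure ((Finset.univ.biUnion fun j =>
    (S j).image (MonoidHom.mulSingle H j) : Finset (∀ j, H j)) : Set (∀ j, H j)) with hD
  have hle : ∀ j, (Subgroup.closure (S j : Set (H j))).map (MonoidHom.mulSingle H j) ≤ D := by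
    intro j
    rw [MonoidHom.map_closure, Subgroup.closure_le]
    rintro _ ⟨x, hx, rfl⟩
    refine Subgroup.subset_closure ?_
    simp only [Finset.coe_biUnion, Finset.coe_univ, Set.mem_univ, Set.iUnion_true,
      Set.mem_iUnion, Finset.coe_image]
    exact ⟨j, x, hx, rfl⟩
  have hpi : Set.pi Set.univ (fun j => (Subgroup.closure (S j : Set (H j)) : Set (H j))) ⊆
      (D : Set (∀ j, H j)) := by
    intro g hg
    refine Subgroup.pi_mem_of_mulSingle_mem g fun j => hle j ?_
    exact Subgroup.mem_map_of_mem (MonoidHom.mulSingle H j) (hg j (Set.mem_univ j))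
  exact (dense_pi Set.univ fun j _ => hS j).mono hpi

end Product

end ProP

/-!
The Hausdorff dimension of a closed subgroup `N` of an infinite compact group with filtration `G_n`
is the limit of `log |N G_n : G_n| / log |G : G_n|` whenever this limit exists: coverings by cosets of
`G_n` give the upper bound, Haar measure on `N` as a mass distribution gives the lower bound
(`hdim_eq_of_tendsto`). So it suffices to understand these quotients.

Let `H` be a finitely generated pro-`p` group of positive rank gradient `ρ`, and put
`u n = log |H : Φ_n(H)|`. Since `|Φ_n : Φ_{n+1}|` is at least `p ^ d(Φ_n)`, and at most exponential
in `|H : Φ_n|` by Schreier's bound,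
`u n + ρ' exp (u n) ≤ u (n + 1) ≤ u n + d' exp (u n)` with constants `ρ', d' > 0`. Everything
follows from this tower-exponential growth.

* Two sequences of this kind have a limiting ratio (possibly infinite): as soon as one exceeds the
  other by a certain constant, the gap explodes, and otherwise their difference is bounded while
  both tend to infinity. Hence for `G = ∏ H_j`, where `Φ_n(G) = ∏ Φ_n(H_j)`, the shares of the
  factors in `log |G : Φ_n(G)|` converge to numbers `β_j` (`exists_tendsto_div_sum`). It is this
  convergence that makes dimensions additive over the factors.
* If `M` is an infinite subset of `H` that is central modulo a normal subgroup `L`, then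
  `log |H : L Φ_n| = o(u n)` (`tendsto_log_index_sup_div`). Indeed, take `k` elements of `M`, and
  let `K` be the normal subgroup that they generate together with `L`. As `K / L` is abelian with
  `k` generators, passing from `L` to `K` changes the logarithm of the index by at most
  `n k log p`. For large `n` the `k` elements are distinct modulo `Φ_n`, so that
  `|H : K Φ_n| ≤ exp (u n) / k`, and Schreier's bound in `H / K` yields
  `log |H : K Φ_{n+1}| ≤ u n + (d' / k) exp (u n)`, which is asymptotically at most
  `d' / (k ρ')` times `u (n + 1)`. Finally `k` is arbitrary.

Let `N` be a closed normal subgroup of `G`, let `M_j` be its projection to `H_j` and `L_j` its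
intersection with `H_j`. Then `∏ L_j ≤ N ≤ ∏ M_j` and `[M_j, H_j] ≤ L_j`. If `M_j` is finite, the
`j`-th factor contributes a bounded amount to `log |N Φ_n : Φ_n|`; if `M_j` is infinite, `L_j` has
full density in `H_j`. Hence the dimension of `N` is the sum of the `β_j` over those `j` for which
`M_j` is infinite (`exists_hdim_eq_sum`). Subproducts of `G` realize every subset of the factors.
-/

namespace ProP

open Filter Topology
open scoped NNReal

/-! ### Sequences of tower-exponential growth -/

section Growth

theorem tendsto_atTop_of_exp_growth {ρ : ℝ} (hρ : 0 < ρ) {u : ℕ → ℝ} (h0 : 0 ≤ u 0)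
    (hu : ∀ n, u n + ρ * Real.exp (u n) ≤ u (n + 1)) :
    (∀ n : ℕ, n * ρ ≤ u n) ∧ Tendsto u atTop atTop := by
  have h : ∀ n : ℕ, n * ρ ≤ u n := by
    intro n
    induction n with
    | zero => simpa using h0
    | succ n ih =>
      have h1 : 0 ≤ u n := le_trans (by positivity) ih
      have h2 : 1 ≤ Real.exp (u n) := Real.one_le_exp h1
      push_cast
      nlinarith [hu n]
  refine ⟨h, tendsto_atTop_mono h ?_⟩
  exact tendsto_natCast_atTop_atTop.atTop_mul_const hρ

theorem nonneg_of_exp_growth {ρ : ℝ} (hρ : 0 < ρ) {u : ℕ → ℝ} (h0 : 0 ≤ u 0)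
    (hu : ∀ n, u n + ρ * Real.exp (u n) ≤ u (n + 1)) (n : ℕ) : 0 ≤ u n :=
  le_trans (by positivity) ((tendsto_atTop_of_exp_growth hρ h0 hu).1 n)

/-- A sequence growing at least like an iterated exponential dominates the index. -/
theorem tendsto_nat_div_of_exp_growth {ρ : ℝ} (hρ : 0 < ρ) {u : ℕ → ℝ} (h0 : 0 ≤ u 0)
    (hu : ∀ n, u n + ρ * Real.exp (u n) ≤ u (n + 1)) :
    Tendsto (fun n : ℕ => (n : ℝ) / u n) atTop (𝓝 0) := by
  have hpos := nonneg_of_exp_growth hρ h0 hu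
  have hlin := (tendsto_atTop_of_exp_growth hρ h0 hu).1
  rw [← tendsto_add_atTop_iff_nat 1]
  -- compare with `u (n + 1) ≥ ρ exp (n ρ)`
  have hlim : Tendsto (fun n : ℕ => ((n : ℝ) + 1) / (ρ * Real.exp (n * ρ))) atTop (𝓝 0) := by
    have h1 : Tendsto (fun x : ℝ => x ^ 1 * Real.exp (-x)) atTop (𝓝 0) :=
      Real.tendsto_pow_mul_exp_neg_atTop_nhds_zero 1
    have h2 : Tendsto (fun x : ℝ => x ^ 0 * Real.exp (-x)) atTop (𝓝 0) :=
      Real.tendsto_pow_mul_exp_neg_atTop_nhds_zero 0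
    have h3 : Tendsto (fun n : ℕ => (n : ℝ) * ρ) atTop atTop :=
      tendsto_natCast_atTop_atTop.atTop_mul_const hρ
    have h4 := ((h1.comp h3).const_mul (1 / ρ ^ 2)).add ((h2.comp h3).const_mul (1 / ρ))
    simp only [mul_zero, add_zero] at h4
    refine h4.congr fun n => ?_
    simp only [Function.comp, Real.exp_neg]
    field_simp
  refine squeeze_zero (fun n => div_nonneg (by positivity) (hpos _)) (fun n => ?_) hlim
  push_cast
  refine div_le_div_of_nonneg_left (by positivity) (by positivity) ?_
  have := Real.exp_le_exp.2 (hlin n)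
  nlinarith [hu n, hpos n]

/-- If `v` has increments at most `d exp (v n)` and stays below `u - log k`, while `u` has
increments at least `ρ exp (u n)`, then `v / u` is asymptotically at most `d / (k ρ)`. -/
theorem eventually_le_mul_of_exp_growth {ρ d k ε : ℝ} (hρ : 0 < ρ) (hd : 0 ≤ d) (hk : 0 < k)
    (hε : d / (k * ρ) < ε) {u v : ℕ → ℝ} (h0 : 0 ≤ u 0)
    (hu : ∀ n, u n + ρ * Real.exp (u n) ≤ u (n + 1))
    (hv : ∀ n, v (n + 1) ≤ v n + d * Real.exp (v n))
    (hvu : ∀ n, v n ≤ u n) (hvk : ∀ᶠ n in atTop, v n ≤ u n - Real.log k) :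
    ∀ᶠ n in atTop, v n ≤ ε * u n := by
  have hε0 : 0 < ε := lt_of_le_of_lt (by positivity) hε
  have htop := (tendsto_atTop_of_exp_growth hρ h0 hu).2
  have hdk : d / k < ε * ρ := by
    rw [div_lt_iff₀ (by positivity)] at hε
    rw [div_lt_iff₀ hk]; linarith
  have hlim : Tendsto (fun x : ℝ => x ^ 1 * Real.exp (-x)) atTop (𝓝 0) :=
    Real.tendsto_pow_mul_exp_neg_atTop_nhds_zero 1
  have hsmall := (hlim.comp htop).eventually (gt_mem_nhds (sub_pos.2 hdk))
  obtain ⟨n0, hn0⟩ := eventually_atTop.1 (hvk.and hsmall)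
  refine eventually_atTop.2 ⟨n0 + 1, fun n hn => ?_⟩
  obtain ⟨m, rfl⟩ : ∃ m, n = m + 1 := ⟨n - 1, by omega⟩
  obtain ⟨h1, h2⟩ := hn0 m (by omega)
  simp only [Function.comp, pow_one, Real.exp_neg] at h2
  have hE := Real.exp_pos (u m)
  rw [← div_eq_mul_inv, div_lt_iff₀ hE] at h2
  have h3 : Real.exp (v m) ≤ Real.exp (u m) / k := by
    calc Real.exp (v m) ≤ Real.exp (u m - Real.log k) := Real.exp_le_exp.2 h1
      _ = _ := by rw [Real.exp_sub, Real.exp_log hk]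
  have h4 : d * Real.exp (v m) ≤ d / k * Real.exp (u m) := by
    calc d * Real.exp (v m) ≤ d * (Real.exp (u m) / k) := by gcongr
      _ = _ := by ring
  have h5 : 0 ≤ u m := nonneg_of_exp_growth hρ h0 hu m
  nlinarith [hv m, hvu m, mul_le_mul_of_nonneg_left (hu m) hε0.le, mul_nonneg hε0.le h5]

/-- The analytic heart of the density of normal subgroups: if for every `k` the sequence `c` is
bounded by a sequence `v` as in `eventually_le_mul_of_exp_growth`, up to an error linear in the
index, then `c` is negligible against `u`. -/
theorem tendsto_div_of_exp_growth {ρ d q : ℝ} (hρ : 0 < ρ) (hd : 0 ≤ d) {u c : ℕ → ℝ}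
    (h0 : 0 ≤ u 0) (hu : ∀ n, u n + ρ * Real.exp (u n) ≤ u (n + 1)) (hc0 : ∀ n, 0 ≤ c n)
    (hc : ∀ k : ℕ, 0 < k → ∃ v : ℕ → ℝ, (∀ n, v (n + 1) ≤ v n + d * Real.exp (v n)) ∧
      (∀ n, v n ≤ u n) ∧ (∀ᶠ n in atTop, v n ≤ u n - Real.log k) ∧
      ∀ n : ℕ, c n ≤ v n + n * (k * q)) :
    Tendsto (fun n => c n / u n) atTop (𝓝 0) := by
  have hpos := nonneg_of_exp_growth hρ h0 hu
  have htop := (tendsto_atTop_of_exp_growth hρ h0 hu).2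
  refine tendsto_order.2 ⟨fun a ha => Eventually.of_forall fun n =>
    ha.trans_le (div_nonneg (hc0 n) (hpos n)), fun ε hε => ?_⟩
  -- choose `k` so large that `d / (k ρ) < ε / 2`
  obtain ⟨k, hk⟩ := exists_nat_gt (d / (ε / 2 * ρ))
  have hk0 : (0 : ℝ) < k := lt_of_le_of_lt (by positivity) hk
  obtain ⟨v, hv, hvu, hvk, hcv⟩ := hc k (by exact_mod_cast hk0)
  have hkε : d / (k * ρ) < ε / 2 := by
    rw [div_lt_iff₀ (by positivity)] at hk ⊢
    linarith
  have h1 := eventually_le_mul_of_exp_growth hρ hd hk0 hkε h0 hu hv hvu hvk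
  have h2 : Tendsto (fun n : ℕ => (n : ℝ) / u n * (k * q)) atTop (𝓝 0) := by
    simpa using (tendsto_nat_div_of_exp_growth hρ h0 hu).mul_const (k * q)
  filter_upwards [h1, h2.eventually (gt_mem_nhds (half_pos hε)), htop.eventually_gt_atTop 0]
    with n hn1 hn2 hn3
  rw [div_mul_eq_mul_div, div_lt_iff₀ hn3] at hn2
  rw [div_lt_iff₀ hn3]
  linarith [hcv n]

/-- Once `u` exceeds `w` by a certain constant, the gap widens at every step and `w / u` tends
to `0`. -/
theorem tendsto_div_zero_of_gap {ρ d D : ℝ} (hρ : 0 < ρ) (hd : 0 ≤ d)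
    (hD : d + 1 ≤ ρ * Real.exp D) {u w : ℕ → ℝ} (hu0 : ∀ n, 0 ≤ u n) (hw0 : ∀ n, 0 ≤ w n)
    (hu : ∀ n, u n + ρ * Real.exp (u n) ≤ u (n + 1))
    (hw : ∀ n, w (n + 1) ≤ w n + d * Real.exp (w n)) {n₀ : ℕ} (h : D ≤ u n₀ - w n₀) :
    Tendsto (fun n => w n / u n) atTop (𝓝 0) := by
  have hexp : ∀ n, Real.exp (u n) = Real.exp (u n - w n) * Real.exp (w n) := fun n => by
    rw [← Real.exp_add]; congr 1; ring
  have hgap : ∀ m : ℕ, D + m ≤ u (n₀ + m) - w (n₀ + m) := by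
    intro m
    induction m with
    | zero => simpa using h
    | succ m ih =>
      rw [← add_assoc]
      push_cast
      set n := n₀ + m
      have hDn : D ≤ u n - w n := le_trans (by linarith [Nat.cast_nonneg (α := ℝ) m]) ih
      have h1 := Real.exp_le_exp.2 hDn
      have h2 : 1 ≤ Real.exp (w n) := Real.one_le_exp (hw0 n)
      have h3 : (d + 1) * Real.exp (w n) ≤ ρ * Real.exp (u n) := by
        rw [hexp n, ← mul_assoc]
        gcongr
        exact hD.trans (by gcongr)
      linarith [hu n, hw n]
  rw [← tendsto_add_atTop_iff_nat (n₀ + 1)]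
  have hlim : Tendsto (fun m : ℕ => (1 + d) / ρ * Real.exp (-(D + m))) atTop (𝓝 0) := by
    have h1 : Tendsto (fun m : ℕ => D + (m : ℝ)) atTop atTop :=
      tendsto_atTop_add_const_left _ _ tendsto_natCast_atTop_atTop
    simpa using (Real.tendsto_exp_neg_atTop_nhds_zero.comp h1).const_mul ((1 + d) / ρ)
  refine squeeze_zero (fun n => div_nonneg (hw0 _) (hu0 _)) (fun m => ?_) hlim
  have hEq : m + (n₀ + 1) = n₀ + m + 1 := by ring
  rw [hEq]
  set n := n₀ + m
  have h1 : w (n + 1) ≤ (1 + d) * Real.exp (w n) := by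
    linarith [hw n, Real.add_one_le_exp (w n)]
  have h2 : ρ * Real.exp (u n) ≤ u (n + 1) := by linarith [hu n, hu0 n]
  calc w (n + 1) / u (n + 1) ≤ (1 + d) * Real.exp (w n) / (ρ * Real.exp (u n)) := by
        gcongr
    _ = (1 + d) / ρ * Real.exp (-(u n - w n)) := by
        rw [hexp n, Real.exp_neg]; field_simp
    _ ≤ _ := by
        have := hgap m
        gcongr

/-- Two sequences whose increments lie between `ρ exp (u n)` and `d exp (u n)`, with constants
depending on the sequence, have a limiting ratio, possibly infinite. -/
theorem tendsto_div_trichotomy {ρ d ρ' d' : ℝ} (hρ : 0 < ρ) (hd : 0 ≤ d) (hρ' : 0 < ρ')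
    (hd' : 0 ≤ d') {u w : ℕ → ℝ} (hu0 : 0 ≤ u 0) (hw0 : 0 ≤ w 0)
    (hul : ∀ n, u n + ρ * Real.exp (u n) ≤ u (n + 1))
    (huu : ∀ n, u (n + 1) ≤ u n + d * Real.exp (u n))
    (hwl : ∀ n, w n + ρ' * Real.exp (w n) ≤ w (n + 1))
    (hwu : ∀ n, w (n + 1) ≤ w n + d' * Real.exp (w n)) :
    (∃ l, Tendsto (fun n => u n / w n) atTop (𝓝 l)) ∨
      Tendsto (fun n => w n / u n) atTop (𝓝 0) := by
  have hu := nonneg_of_exp_growth hρ hu0 hul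
  have hw := nonneg_of_exp_growth hρ' hw0 hwl
  have hex : ∀ a b : ℝ, 0 < a → ∃ D : ℝ, b + 1 ≤ a * Real.exp D := fun a b ha =>
    ⟨(b + 1) / a, by
      have := Real.add_one_le_exp ((b + 1) / a)
      calc b + 1 = a * ((b + 1) / a) := by field_simp
        _ ≤ _ := by gcongr; linarith⟩
  obtain ⟨D, hD⟩ := hex ρ d' hρ
  obtain ⟨D', hD'⟩ := hex ρ' d hρ'
  by_cases h1 : ∃ n, D ≤ u n - w n
  · obtain ⟨n, hn⟩ := h1
    exact Or.inr (tendsto_div_zero_of_gap hρ hd' hD hu hw hul hwu hn)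
  by_cases h2 : ∃ n, D' ≤ w n - u n
  · obtain ⟨n, hn⟩ := h2
    exact Or.inl ⟨0, tendsto_div_zero_of_gap hρ' hd hD' hw hu hwl huu hn⟩
  -- the difference stays bounded, so the ratio tends to `1`
  push Not at h1 h2
  refine Or.inl ⟨1, ?_⟩
  have htop := (tendsto_atTop_of_exp_growth hρ' hw0 hwl).2
  have hbd : Tendsto (fun n => (u n - w n) / w n) atTop (𝓝 0) := by
    have hl : Tendsto (fun n => -D' / w n) atTop (𝓝 0) := htop.const_div_atTop _
    have hr : Tendsto (fun n => D / w n) atTop (𝓝 0) := htop.const_div_atTop _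
    refine tendsto_of_tendsto_of_tendsto_of_le_of_le hl hr (fun n => ?_) (fun n => ?_)
    · exact div_le_div_of_nonneg_right (by linarith [h2 n]) (hw n)
    · exact div_le_div_of_nonneg_right (h1 n).le (hw n)
  have h3 := hbd.const_add 1
  rw [add_zero] at h3
  refine h3.congr' ?_
  filter_upwards [htop.eventually_gt_atTop 0] with n hn
  field_simp
  ring

/-- The shares of finitely many sequences of tower-exponential growth in their sum converge. -/
theorem exists_tendsto_div_sum {ι : Type*} [Fintype ι] {ρ d : ι → ℝ} (hρ : ∀ j, 0 < ρ j)
    (hd : ∀ j, 0 ≤ d j) {u : ι → ℕ → ℝ} (hu0 : ∀ j, 0 ≤ u j 0)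
    (hul : ∀ j n, u j n + ρ j * Real.exp (u j n) ≤ u j (n + 1))
    (huu : ∀ j n, u j (n + 1) ≤ u j n + d j * Real.exp (u j n)) (j : ι) :
    ∃ β, 0 ≤ β ∧ Tendsto (fun n => u j n / ∑ i, u i n) atTop (𝓝 β) := by
  have hu := fun j => nonneg_of_exp_growth (hρ j) (hu0 j) (hul j)
  have htop := fun j => (tendsto_atTop_of_exp_growth (hρ j) (hu0 j) (hul j)).2
  by_cases h : ∃ i, Tendsto (fun n => u j n / u i n) atTop (𝓝 0)
  · obtain ⟨i, hi⟩ := h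
    refine ⟨0, le_rfl, squeeze_zero'
      (Eventually.of_forall fun n => div_nonneg (hu j n) (Finset.sum_nonneg fun i _ => hu i n))
      ?_ hi⟩
    filter_upwards [(htop i).eventually_gt_atTop 0] with n hn
    exact div_le_div_of_nonneg_left (hu j n) hn
      (Finset.single_le_sum (f := fun i => u i n) (fun i _ => hu i n) (Finset.mem_univ i))
  · push Not at h
    have hl : ∀ i, ∃ l, Tendsto (fun n => u i n / u j n) atTop (𝓝 l) := fun i =>
      (tendsto_div_trichotomy (hρ i) (hd i) (hρ j) (hd j) (hu0 i) (hu0 j) (hul i) (huu i)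
        (hul j) (huu j)).resolve_right (h i)
    choose l hl using hl
    have hl0 : ∀ i, 0 ≤ l i := fun i =>
      ge_of_tendsto' (hl i) fun n => div_nonneg (hu i n) (hu j n)
    have hlj : l j = 1 := by
      refine tendsto_nhds_unique (hl j) (tendsto_const_nhds.congr' ?_)
      filter_upwards [(htop j).eventually_gt_atTop 0] with n hn
      rw [div_self hn.ne']
    have hs : 1 ≤ ∑ i, l i := by
      rw [← hlj]
      exact Finset.single_le_sum (fun i _ => hl0 i) (Finset.mem_univ j)
    refine ⟨(∑ i, l i)⁻¹, by positivity, ?_⟩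
    have hsum : Tendsto (fun n => ∑ i, u i n / u j n) atTop (𝓝 (∑ i, l i)) :=
      tendsto_finsetSum _ fun i _ => hl i
    refine (hsum.inv₀ (by positivity)).congr fun n => ?_
    rw [← Finset.sum_div, inv_div]

end Growth

/-! ### Hausdorff dimension of closed subgroups -/

section MassDistribution

open MeasureTheory MeasureTheory.Measure

/-- Mass distribution principle, for a probability measure on a space mapping continuously into
the set in question. -/
theorem le_dimH_of_measure_preimage_le {X Y : Type*} [EMetricSpace X] [TopologicalSpace Y]
    [MeasurableSpace Y] [BorelSpace Y] (μ : Measure Y) [IsProbabilityMeasure μ] {f : Y → X}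
    (hf : Continuous f) {s : Set X} (hfs : ∀ y, f y ∈ s) {t : ℝ≥0} {ε : ℝ≥0∞} (hε : 0 < ε)
    (h : ∀ A : Set X, Metric.ediam A ≤ ε → μ (f ⁻¹' A) ≤ Metric.ediam A ^ (t : ℝ)) :
    (t : ℝ≥0∞) ≤ dimH s := by
  borelize X
  have hle : μ.map f ≤ μH[(t : ℝ)] := by
    refine le_hausdorffMeasure _ _ ε hε fun A hA => ?_
    rw [← Metric.ediam_closure] at hA ⊢
    refine (measure_mono subset_closure).trans ?_
    rw [map_apply hf.measurable isClosed_closure.measurableSet]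
    exact h _ hA
  refine le_dimH_of_hausdorffMeasure_ne_zero fun h0 => ?_
  have h1 : μ.map f s = 0 := le_antisymm ((hle s).trans h0.le) zero_le
  have h2 : μ (f ⁻¹' s) ≤ μ.map f s := le_map_apply hf.measurable.aemeasurable s
  have h3 : f ⁻¹' s = Set.univ := Set.eq_univ_of_forall hfs
  rw [h1, h3, measure_univ] at h2
  exact one_ne_zero (le_antisymm h2 zero_le)

end MassDistribution

section HausdorffDimension

variable {G : Type*} [Group G] [TopologicalSpace G]

/-- The group `G` regarded as a metric space by means of the filtration `S`; a type synonym,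
since `G` carries a topology of its own. -/
def Filtration.MetricGroup (_S : Filtration G) : Type _ := G

/-- The identity map of `G`, with the metric of `S` on its target. -/
def Filtration.toMetric (S : Filtration G) (x : G) : S.MetricGroup := x

noncomputable instance (S : Filtration G) : EMetricSpace S.MetricGroup := S.emetricSpace

theorem Filtration.edist_le (S : Filtration G) {x y : G} {n : ℕ} (h : x⁻¹ * y ∈ S.toFun n) :
    S.edist x y ≤ ((S.toFun n).index : ℝ≥0∞)⁻¹ := by
  rw [Filtration.edist]
  split_ifs
  · exact zero_le
  · exact iInf₂_le n h

theorem Filtration.index_mono (S : Filtration G) (hS : ∀ n, (S.toFun n).index ≠ 0) {m n : ℕ}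
    (h : m ≤ n) : (S.toFun m).index ≤ (S.toFun n).index := by
  have : (S.toFun n).FiniteIndex := ⟨hS n⟩
  exact Subgroup.index_antitone (S.antitone h)

theorem Filtration.le_edist (S : Filtration G) (hS : ∀ n, (S.toFun n).index ≠ 0) {x y : G}
    {n : ℕ} (h : x⁻¹ * y ∉ S.toFun (n + 1)) : ((S.toFun n).index : ℝ≥0∞)⁻¹ ≤ S.edist x y := by
  have hxy : x ≠ y := by
    rintro rfl
    exact h (by simp [one_mem])
  rw [Filtration.edist, if_neg hxy]
  refine le_iInf₂ fun i hi => ENNReal.inv_le_inv.2 ?_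
  have hin : i ≤ n := by
    by_contra hc
    exact h (S.antitone (by omega) hi)
  exact_mod_cast S.index_mono hS hin

theorem Filtration.edist_eq_top (S : Filtration G) {x y : G} (h : x⁻¹ * y ∉ S.toFun 0) :
    S.edist x y = ⊤ := by
  have hxy : x ≠ y := by
    rintro rfl
    exact h (by simp [one_mem])
  rw [Filtration.edist, if_neg hxy]
  simp only [iInf_eq_top]
  exact fun i hi => absurd (S.antitone (Nat.zero_le i) hi) h

theorem Filtration.exists_notMem (S : Filtration G) {x : G} (hx : x ≠ 1) :
    ∃ n, x ∉ S.toFun n := by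
  by_contra! h
  exact hx (by simpa [S.iInf_eq_bot] using Subgroup.mem_iInf.2 h)

theorem Filtration.continuous_toMetric [IsTopologicalGroup G] (S : Filtration G)
    (hS : Tendsto (fun n => ((S.toFun n).index : ℝ)) atTop atTop) :
    Continuous S.toMetric := by
  refine continuous_iff_continuousAt.2 fun x => ?_
  refine (Metric.nhds_basis_eball (x := S.toMetric x)).tendsto_right_iff.2 fun ε hε => ?_
  have hS' : Tendsto (fun n => ((S.toFun n).index : ℝ≥0∞)⁻¹) atTop (𝓝 0) :=
    ENNReal.tendsto_inv_nat_nhds_zero.comp (tendsto_natCast_atTop_iff.1 hS)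
  obtain ⟨n, hn⟩ := (hS'.eventually (gt_mem_nhds hε)).exists
  have hopen : IsOpen {y : G | y⁻¹ * x ∈ S.toFun n} :=
    (S.isOpen n).preimage (by fun_prop : Continuous fun y : G => y⁻¹ * x)
  filter_upwards [hopen.mem_nhds (by simp [one_mem] : x⁻¹ * x ∈ S.toFun n)] with y hy
  exact lt_of_le_of_lt (S.edist_le hy) hn

variable [IsTopologicalGroup G] [CompactSpace G]

theorem Filtration.index_ne_zero (S : Filtration G) (n : ℕ) : (S.toFun n).index ≠ 0 := by
  have : Finite (G ⧸ S.toFun n) := Subgroup.quotient_finite_of_isOpen _ (S.isOpen n)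
  exact Subgroup.index_ne_zero_of_finite

open MeasureTheory MeasureTheory.Measure in
/-- Covering `N` by cosets of the `n`-th term of the filtration bounds its dimension from
above. -/
theorem hdim_le_of_eventually (S : Filtration G) (N : Subgroup G)
    (hS : Tendsto (fun n => ((S.toFun n).index : ℝ)) atTop atTop) {t : ℝ≥0}
    (h : ∀ᶠ n in atTop, ((S.toFun n).relIndex N : ℝ≥0∞) ≤ ((S.toFun n).index : ℝ≥0∞) ^ (t : ℝ)) :
    hdim S N ≤ t := by
  have hfin : ∀ n, Finite (N ⧸ (S.toFun n).subgroupOf N) := fun n => by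
    have : (S.toFun n).FiniteIndex := ⟨S.index_ne_zero n⟩
    infer_instance
  have := fun n => Fintype.ofFinite (N ⧸ (S.toFun n).subgroupOf N)
  have hS' : Tendsto (fun n => ((S.toFun n).index : ℝ≥0∞)⁻¹) atTop (𝓝 0) :=
    ENNReal.tendsto_inv_nat_nhds_zero.comp (tendsto_natCast_atTop_iff.1 hS)
  let A : ∀ n, (N ⧸ (S.toFun n).subgroupOf N) → Set S.MetricGroup := fun n q =>
    {y : G | ((q.out : N) : G)⁻¹ * y ∈ S.toFun n}
  have hA : ∀ n q, Metric.ediam (A n q) ≤ ((S.toFun n).index : ℝ≥0∞)⁻¹ := by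
    intro n q
    refine Metric.ediam_le fun (y : G) hy (z : G) hz => S.edist_le ?_
    have hy : ((q.out : N) : G)⁻¹ * y ∈ S.toFun n := hy
    have hz : ((q.out : N) : G)⁻¹ * z ∈ S.toFun n := hz
    have := mul_mem (inv_mem hy) hz
    rwa [mul_inv_rev, inv_inv, mul_assoc, mul_inv_cancel_left] at this
  let s : Set S.MetricGroup := (N : Set G)
  have hcov : ∀ n, s ⊆ ⋃ q, A n q := by
    intro n x hx
    refine Set.mem_iUnion.2 ⟨QuotientGroup.mk (⟨x, hx⟩ : N), ?_⟩
    have : (QuotientGroup.mk (QuotientGroup.mk (⟨x, hx⟩ : N) :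
        N ⧸ (S.toFun n).subgroupOf N).out : N ⧸ (S.toFun n).subgroupOf N) =
        QuotientGroup.mk (⟨x, hx⟩ : N) := QuotientGroup.out_eq' _
    have hmem : (QuotientGroup.mk (⟨x, hx⟩ : N) : N ⧸ (S.toFun n).subgroupOf N).out⁻¹ *
      (⟨x, hx⟩ : N) ∈ (S.toFun n).subgroupOf N := QuotientGroup.eq.1 this
    exact hmem
  borelize S.MetricGroup
  have hH : μH[(t : ℝ)] s ≤ 1 := by
    refine (hausdorffMeasure_le_liminf_sum (t : ℝ) s _ hS' A
      (Eventually.of_forall hA) (Eventually.of_forall hcov)).trans ?_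
    refine liminf_le_of_frequently_le' (Eventually.frequently ?_)
    filter_upwards [h] with n hn
    calc ∑ q, Metric.ediam (A n q) ^ (t : ℝ)
        ≤ ∑ q : N ⧸ (S.toFun n).subgroupOf N, ((S.toFun n).index : ℝ≥0∞)⁻¹ ^ (t : ℝ) :=
          Finset.sum_le_sum fun q _ => ENNReal.rpow_le_rpow (hA n q) t.coe_nonneg
      _ = ((S.toFun n).relIndex N : ℝ≥0∞) * (((S.toFun n).index : ℝ≥0∞) ^ (t : ℝ))⁻¹ := by
          rw [Finset.sum_const, nsmul_eq_mul, Finset.card_univ, ← Nat.card_eq_fintype_card,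
            ENNReal.inv_rpow]
          rfl
      _ ≤ 1 := (mul_le_mul_left hn _).trans (ENNReal.mul_inv_le_one _)
  exact dimH_le_of_hausdorffMeasure_ne_top (X := S.MetricGroup)
    (ne_top_of_le_ne_top ENNReal.one_ne_top hH)

open MeasureTheory MeasureTheory.Measure in
/-- The normalized Haar measure of a closed subgroup is a mass distribution bounding its
dimension from below. -/
theorem le_hdim_of_eventually (S : Filtration G) (N : Subgroup G) (hN : IsClosed (N : Set G))
    (hS : Tendsto (fun n => ((S.toFun n).index : ℝ)) atTop atTop) {t : ℝ≥0} (ht : 0 < t)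
    (h : ∀ᶠ n in atTop, ((S.toFun n).index : ℝ≥0∞) ^ (t : ℝ) ≤ ((S.toFun n).relIndex N : ℝ≥0∞)) :
    (t : ℝ≥0∞) ≤ hdim S N := by
  obtain ⟨n₀, hn₀⟩ := eventually_atTop.1 h
  have hidx := S.index_ne_zero
  have : CompactSpace N := isCompact_iff_compactSpace.1 hN.isCompact
  let : MeasurableSpace N := borel N
  have : BorelSpace N := ⟨rfl⟩
  set μ : Measure N := haarMeasure ⊤
  have hμ1 : μ Set.univ = 1 := haarMeasure_self (K₀ := (⊤ : TopologicalSpace.PositiveCompacts N))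
  have : IsProbabilityMeasure μ := ⟨hμ1⟩
  -- a coset of the `n`-th term meets `N` in a set of measure `0` or `|N G_n : G_n|⁻¹`
  have hcoset : ∀ (a : G) (n : ℕ), n₀ ≤ n →
      μ {x : N | a⁻¹ * x ∈ S.toFun n} ≤ (((S.toFun n).index : ℝ≥0∞)⁻¹) ^ (t : ℝ) := by
    intro a n hn
    rcases Set.eq_empty_or_nonempty {x : N | a⁻¹ * x ∈ S.toFun n} with he | ⟨x₀, hx₀⟩
    · rw [he, measure_empty]; exact zero_le
    have hsub : {x : N | a⁻¹ * x ∈ S.toFun n} ⊆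
        (fun y => x₀⁻¹ * y) ⁻¹' ((S.toFun n).subgroupOf N : Set N) := by
      intro x hx
      have hx₀ : a⁻¹ * (x₀ : G) ∈ S.toFun n := hx₀
      have hx : a⁻¹ * (x : G) ∈ S.toFun n := hx
      have := mul_mem (inv_mem hx₀) hx
      rwa [mul_inv_rev, inv_inv, mul_assoc, mul_inv_cancel_left] at this
    refine (measure_mono hsub).trans ?_
    rw [measure_preimage_mul]
    have hfi : (S.toFun n).FiniteIndex := ⟨hidx n⟩
    have hmeas : MeasurableSet ((S.toFun n).subgroupOf N : Set N) :=
      ((S.isOpen n).preimage continuous_subtype_val).measurableSet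
    have hmul := Subgroup.index_mul_measure ((S.toFun n).subgroupOf N) hmeas μ
    rw [hμ1] at hmul
    rw [ENNReal.inv_rpow]
    refine le_trans (le_of_eq ?_) (ENNReal.inv_le_inv.2 (hn₀ n hn))
    exact ENNReal.eq_inv_of_mul_eq_one_left (by rw [mul_comm]; exact hmul)
  have hpt : ∀ a : G, μ {x : N | a = x} = 0 := by
    intro a
    have hlim : Tendsto (fun n => ((S.toFun n).index : ℝ≥0∞)⁻¹ ^ (t : ℝ)) atTop (𝓝 0) := by
      have h1 := ENNReal.tendsto_inv_nat_nhds_zero.comp (tendsto_natCast_atTop_iff.1 hS)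
      have h2 := ((ENNReal.continuous_rpow_const (y := (t : ℝ))).tendsto 0).comp h1
      rwa [ENNReal.zero_rpow_of_pos (by exact_mod_cast ht)] at h2
    refine le_antisymm (ge_of_tendsto hlim (eventually_atTop.2 ⟨n₀, fun n hn => ?_⟩)) zero_le
    refine (measure_mono ?_).trans (hcoset a n hn)
    intro x hx
    have hx : a = x := hx
    simp [← hx, one_mem]
  have hpos : ∀ n, (0 : ℝ≥0∞) < ((S.toFun n).index : ℝ≥0∞)⁻¹ := fun n => by simp
  have hfin : ∀ n, ((S.toFun n).index : ℝ≥0∞)⁻¹ ≠ ⊤ := fun n => by simpa using hidx n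
  refine le_dimH_of_measure_preimage_le (X := S.MetricGroup) μ
    (f := fun x : N => S.toMetric x)
    ((S.continuous_toMetric hS).comp continuous_subtype_val) (fun x => x.2)
    (ε := ((S.toFun n₀).index : ℝ≥0∞)⁻¹ / 2) (ENNReal.half_pos (hpos n₀).ne') fun A hA => ?_
  by_cases hsub : A.Subsingleton
  · rcases A.eq_empty_or_nonempty with rfl | ⟨a, ha⟩
    · simp
    · refine le_trans (measure_mono fun x hx => ?_) ((hpt a).le.trans zero_le)
      exact hsub ha hx
  obtain ⟨(a : G), ha, (b : G), hb, hab⟩ := Set.not_subsingleton_iff.1 hsub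
  -- the first term `n` of the filtration for which `A` is not contained in a coset
  have hex : ∃ n, ∃ y : G, S.toMetric y ∈ A ∧ a⁻¹ * y ∉ S.toFun n := by
    obtain ⟨n, hn⟩ := S.exists_notMem (x := a⁻¹ * b)
      (fun h => hab (inv_mul_eq_one (G := G) |>.1 h))
    exact ⟨n, b, hb, hn⟩
  classical
  obtain ⟨y, hy, hyn⟩ := Nat.find_spec hex
  have hlt : Metric.ediam A < ((S.toFun n₀).index : ℝ≥0∞)⁻¹ :=
    hA.trans_lt (ENNReal.half_lt_self (hpos n₀).ne' (hfin n₀))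
  have hdist : S.edist a y ≤ Metric.ediam A :=
    Metric.edist_le_ediam_of_mem (X := S.MetricGroup) ha hy
  -- the filtration need not start at `G`; elements in different cosets of its first term have
  -- infinite distance
  rcases Nat.eq_zero_or_pos (Nat.find hex) with h0 | h0
  · rw [h0] at hyn
    rw [S.edist_eq_top hyn, top_le_iff] at hdist
    rw [hdist] at hlt
    exact absurd hlt (by simp)
  obtain ⟨m, hm⟩ : ∃ m, Nat.find hex = m + 1 := ⟨Nat.find hex - 1, by omega⟩
  rw [hm] at hyn
  have hle := (S.le_edist hidx hyn).trans hdist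
  have hmn : n₀ ≤ m := by
    by_contra hc
    have h1 := S.index_mono hidx (Nat.le_of_lt (not_le.1 hc))
    have h2 : ((S.toFun n₀).index : ℝ≥0∞)⁻¹ ≤ ((S.toFun m).index : ℝ≥0∞)⁻¹ :=
      ENNReal.inv_le_inv.2 (by exact_mod_cast h1)
    exact absurd (h2.trans hle) (not_le.2 hlt)
  refine (measure_mono ?_).trans ((hcoset a m hmn).trans (ENNReal.rpow_le_rpow hle t.coe_nonneg))
  intro x hx
  have hmin := Nat.find_min hex (m := m) (by omega)
  push Not at hmin
  exact hmin _ hx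

/-- If the logarithmic densities `log |N G_n : G_n| / log |G : G_n|` converge, then their limit
is the Hausdorff dimension of the closed subgroup `N`. -/
theorem hdim_eq_of_tendsto (S : Filtration G) (N : Subgroup G) (hN : IsClosed (N : Set G))
    (hS : Tendsto (fun n => Real.log (S.toFun n).index) atTop atTop) {β : ℝ}
    (h : Tendsto (fun n => Real.log ((S.toFun n).relIndex N) / Real.log (S.toFun n).index)
      atTop (𝓝 β)) : hdim S N = ENNReal.ofReal β := by
  have hidx : ∀ n, (0 : ℝ) < (S.toFun n).index := fun n => by
    exact_mod_cast Nat.pos_of_ne_zero (S.index_ne_zero n)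
  have hrel : ∀ n, (0 : ℝ) < (S.toFun n).relIndex N := fun n => by
    have : (S.toFun n).FiniteIndex := ⟨S.index_ne_zero n⟩
    exact_mod_cast Nat.pos_of_ne_zero
      (Subgroup.FiniteIndex.index_ne_zero (H := (S.toFun n).subgroupOf N))
  have hS' : Tendsto (fun n => ((S.toFun n).index : ℝ)) atTop atTop :=
    (Real.tendsto_exp_atTop.comp hS).congr fun n => Real.exp_log (hidx n)
  have hβ : 0 ≤ β := ge_of_tendsto' h fun n =>
    div_nonneg (Real.log_natCast_nonneg _) (Real.log_natCast_nonneg _)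
  lift β to ℝ≥0 using hβ
  rw [ENNReal.ofReal_coe_nnreal]
  have hpos := hS.eventually_gt_atTop 0
  have hcast : ∀ (n : ℕ) (t : ℝ≥0), ((S.toFun n).index : ℝ≥0∞) ^ (t : ℝ) =
      ENNReal.ofReal (((S.toFun n).index : ℝ) ^ (t : ℝ)) := fun n t => by
    rw [← ENNReal.ofReal_natCast, ENNReal.ofReal_rpow_of_nonneg (hidx n).le t.coe_nonneg]
  have hexp : ∀ (n : ℕ) (t : ℝ≥0), ((S.toFun n).index : ℝ) ^ (t : ℝ) =
      Real.exp (t * Real.log (S.toFun n).index) := fun n t => by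
    rw [Real.rpow_def_of_pos (hidx n), mul_comm]
  refine le_antisymm ?_ ?_
  · refine ENNReal.le_of_forall_pos_le_add fun ε hε _ => ?_
    rw [← ENNReal.coe_add]
    refine hdim_le_of_eventually S N hS' ?_
    have hlt : (β : ℝ) < ((β + ε : ℝ≥0) : ℝ) := by exact_mod_cast lt_add_of_pos_right β hε
    filter_upwards [hpos, h.eventually (gt_mem_nhds hlt)] with n hn1 hn2
    rw [hcast, ← ENNReal.ofReal_natCast]
    refine ENNReal.ofReal_le_ofReal ?_
    rw [hexp, ← Real.log_le_iff_le_exp (hrel n)]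
    exact ((div_lt_iff₀ hn1).1 hn2).le
  · refine le_of_forall_lt fun c hc => ?_
    obtain ⟨t, hct, ht⟩ := ENNReal.lt_iff_exists_nnreal_btwn.1 hc
    refine hct.trans_le (le_hdim_of_eventually S N hN hS' ?_ ?_)
    · exact_mod_cast zero_le.trans_lt hct
    have ht' : (t : ℝ) < β := by exact_mod_cast ht
    filter_upwards [hpos, h.eventually (lt_mem_nhds ht')] with n hn1 hn2
    rw [hcast, ← ENNReal.ofReal_natCast]
    refine ENNReal.ofReal_le_ofReal ?_
    rw [hexp, ← Real.le_log_iff_exp_le (hrel n)]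
    exact ((lt_div_iff₀ hn1).1 hn2).le

end HausdorffDimension

/-! ### Generators of finite `p`-groups and of open subgroups -/

section Generation

/-- A commutative homomorphic image of exponent dividing `e` of a group with `r` generators has at
most `e ^ r` elements. -/
theorem card_range_le_pow_rank {D Q : Type*} [Group D] [Group.FG D] [Group Q] (f : D →* Q)
    {e : ℕ} (he : 0 < e) (hc : ∀ a b, f a * f b = f b * f a) (hp : ∀ a, f a ^ e = 1) :
    Nat.card f.range ≤ e ^ Group.rank D := by
  have hcomm : ∀ a b : f.range, a * b = b * a := by
    rintro ⟨_, a, rfl⟩ ⟨_, b, rfl⟩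
    exact Subtype.ext (hc a b)
  let : CommGroup f.range := { mul_comm := hcomm }
  have : Group.FG f.range := Group.fg_of_surjective f.rangeRestrict_surjective
  have h1 : Nat.card f.range ∣ e ^ Group.rank f.range := by
    refine card_dvd_exponent_pow_rank' f.range ?_
    rintro ⟨_, a, rfl⟩
    exact Subtype.ext (hp a)
  exact (Nat.le_of_dvd (pow_pos he _) h1).trans
    (Nat.pow_le_pow_right he (Group.rank_le_of_surjective f.rangeRestrict
      f.rangeRestrict_surjective))

/-- A finite `p`-group has a generating set whose elements can be added one by one, each
multiplying the order of the subgroup generated so far by at least `p`. -/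
theorem exists_finset_closure_eq_top (p : ℕ) [Fact p.Prime] {E : Type*} [Group E] [Finite E]
    (hE : IsPGroup p E) :
    ∃ S : Finset E, Subgroup.closure (S : Set E) = ⊤ ∧ p ^ S.card ≤ Nat.card E := by
  classical
  let P : Set (Subgroup E) :=
    {K | ∃ S : Finset E, Subgroup.closure (S : Set E) = K ∧ p ^ S.card ≤ Nat.card K}
  obtain ⟨K, ⟨S, hSK, hS⟩, hmax⟩ := (Set.toFinite P).exists_maximal ⟨⊥, ∅, by simp, by simp⟩
  by_cases hK : K = ⊤
  · subst hK
    exact ⟨S, hSK, by simpa using hS⟩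
  exfalso
  obtain ⟨x, hx⟩ : ∃ x, x ∉ K := by
    by_contra! h
    exact hK (eq_top_iff.2 fun x _ => h x)
  set K' := Subgroup.closure ((insert x S : Finset E) : Set E)
  have hxK' : x ∈ K' := Subgroup.subset_closure (by simp)
  have hle : K ≤ K' := by
    rw [← hSK]
    exact Subgroup.closure_mono (by simp)
  refine hx (hmax (y := K') ⟨insert x S, rfl, ?_⟩ hle hxK')
  have hxS : x ∉ S := fun h => hx (hSK ▸ Subgroup.subset_closure h)
  obtain ⟨m, hm⟩ := (hE.to_subgroup K').index (K.subgroupOf K')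
  have hm0 : m ≠ 0 := by
    rintro rfl
    rw [pow_zero, Subgroup.index_eq_one, Subgroup.subgroupOf_eq_top] at hm
    exact hx (hm hxK')
  have hcard : Nat.card K * p ^ m = Nat.card K' := by
    rw [← hm, ← Nat.card_congr (Subgroup.subgroupOfEquivOfLe hle).toEquiv]
    exact Subgroup.card_mul_index _
  rw [Finset.card_insert_of_notMem hxS, pow_succ, ← hcard]
  exact Nat.mul_le_mul hS (Nat.le_self_pow hm0 p)

/-- A proper subgroup of a finite `p`-group lies in a proper subgroup containing all
commutators and `p`-th powers. -/
theorem exists_le_ne_top_of_isPGroup (p : ℕ) [Fact p.Prime] {Q : Type*} [Group Q] [Finite Q]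
    (hQ : IsPGroup p Q) {M : Subgroup Q} (hM : M ≠ ⊤) :
    ∃ L : Subgroup Q, M ≤ L ∧ L ≠ ⊤ ∧ (∀ x y : Q, ⁅x, y⁆ ∈ L) ∧ ∀ x : Q, x ^ p ∈ L := by
  have hnil : Group.IsNilpotent Q := hQ.isNilpotent
  obtain ⟨C, hC, hMC⟩ := (eq_top_or_exists_le_coatom M).resolve_left hM
  have : C.Normal :=
    Subgroup.NormalizerCondition.normal_of_coatom C Group.normalizerCondition_of_isNilpotent hC
  -- no need for `Q ⧸ C` to have order `p`: a proper subgroup of it, suitably chosen, is enough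
  have htop : (⊤ : Subgroup (Q ⧸ C)) ≠ ⊥ := by
    intro h
    refine hC.1 (eq_top_iff.2 fun x _ => ?_)
    have : (x : Q ⧸ C) ∈ (⊥ : Subgroup (Q ⧸ C)) := h ▸ Subgroup.mem_top _
    exact (QuotientGroup.eq_one_iff x).1 (Subgroup.mem_bot.1 this)
  obtain ⟨L, hL, h1, h2⟩ := exists_lt_of_isPGroup p (hQ.to_quotient C) ⊤ htop
  refine ⟨L.comap (QuotientGroup.mk' C), fun x hx => ?_, fun h => hL.ne ?_, fun x y => ?_,
    fun x => ?_⟩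
  · have : QuotientGroup.mk' C x = 1 := (QuotientGroup.eq_one_iff x).2 (hMC hx)
    rw [Subgroup.mem_comap, this]
    exact one_mem L
  · rw [eq_top_iff]
    intro x _
    obtain ⟨y, rfl⟩ := QuotientGroup.mk'_surjective C x
    have : y ∈ L.comap (QuotientGroup.mk' C) := h ▸ Subgroup.mem_top y
    exact this
  · rw [Subgroup.mem_comap, map_commutatorElement]
    exact h1 _ (Subgroup.mem_top _) _ (Subgroup.mem_top _)
  · rw [Subgroup.mem_comap, map_pow]
    exact h2 _ (Subgroup.mem_top _)

variable {H : Type*} [Group H] [TopologicalSpace H] [IsTopologicalGroup H]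

/-- Elements generating `U` modulo its Frattini subgroup generate `U` modulo every open normal
subgroup. -/
theorem le_sup_of_le_sup_frattiniStep (p : ℕ) [Fact p.Prime] (hH : IsProP p H)
    {D U O : Subgroup H} (hDU : D ≤ U) (hD : U ≤ D ⊔ frattiniStep p U) (hO : O.Normal)
    (hOo : IsOpen (O : Set H)) : U ≤ D ⊔ O := by
  have := hH.compact
  have : Finite (H ⧸ O) := Subgroup.quotient_finite_of_isOpen O hOo
  have hQ : IsPGroup p (H ⧸ O) := by
    obtain ⟨k, hk⟩ := hH.index_eq_pow O hO hOo
    exact IsPGroup.of_card (n := k) (by rw [← hk]; rfl)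
  set f := QuotientGroup.mk' O with hf
  have hmap : U.map f ≤ D.map f := by
    by_contra hlt
    rw [← Subgroup.subgroupOf_eq_top] at hlt
    obtain ⟨L, hML, hL, h1, h2⟩ :=
      exists_le_ne_top_of_isPGroup p (hQ.to_subgroup (U.map f)) hlt
    set W := (L.map (U.map f).subtype).comap f with hW
    have hWo : IsOpen (W : Set H) := by
      refine Subgroup.isOpen_mono (H₁ := O) (fun x hx => ?_) hOo
      have : f x = 1 := (QuotientGroup.eq_one_iff x).2 hx
      rw [hW, Subgroup.mem_comap, this]
      exact one_mem _
    have hmem : ∀ x ∈ U, f x ∈ U.map f := fun x hx => Subgroup.mem_map_of_mem f hx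
    have hPhi : frattiniStep p U ≤ W := by
      refine frattiniStep_le p (Subgroup.isClosed_of_isOpen _ hWo) (fun x hx y hy => ?_)
        fun x hx => ?_
      · rw [hW, Subgroup.mem_comap, map_commutatorElement]
        exact ⟨_, h1 ⟨f x, hmem x hx⟩ ⟨f y, hmem y hy⟩, rfl⟩
      · rw [hW, Subgroup.mem_comap, map_pow]
        exact ⟨_, h2 ⟨f x, hmem x hx⟩, rfl⟩
    have hDW : D ≤ W := fun x hx =>
      ⟨⟨f x, hmem x (hDU hx)⟩, hML (Subgroup.mem_map_of_mem f hx), rfl⟩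
    refine hL (eq_top_iff.2 ?_)
    rintro ⟨_, x, hx, rfl⟩ _
    obtain ⟨y, hy, hxy⟩ := (hD.trans (sup_le hDW hPhi)) hx
    have hy' : y = ⟨f x, hmem x hx⟩ := Subtype.ext hxy
    exact hy' ▸ hy
  rw [Subgroup.map_le_iff_le_comap, Subgroup.comap_map_eq, hf, QuotientGroup.ker_mk'] at hmap
  exact hmap

/-- Half of the Burnside basis theorem: `p ^ d(U)` is at most the index in `U` of the Frattini
subgroup of `U`. -/
theorem pow_topRank_le_relIndex (p : ℕ) [Fact p.Prime] (hH : IsProP p H) (hfg : IsTopFG H)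
    {U : Subgroup H} (hUn : U.Normal) (hU : IsOpen (U : Set H)) :
    p ^ topRank U ≤ (frattiniStep p U).relIndex U := by
  classical
  have := hH.compact
  have := hH.t2
  have := hH.totallyDisconnected
  set V := frattiniStep p U
  have hVn : V.Normal := frattiniStep_normal p U hUn
  have hVo : IsOpen (V : Set H) := isOpen_frattiniStep p hfg U hUn hU
  have : Finite (H ⧸ V) := Subgroup.quotient_finite_of_isOpen V hVo
  have : V.FiniteIndex := Subgroup.finiteIndex_of_finite_quotient
  have hE : IsPGroup p (U ⧸ V.subgroupOf U) := by
    intro a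
    obtain ⟨g, rfl⟩ := QuotientGroup.mk_surjective a
    refine ⟨1, ?_⟩
    rw [pow_one, ← QuotientGroup.mk_pow]
    exact (QuotientGroup.eq_one_iff _).2 (pow_mem_frattiniStep p g.2)
  obtain ⟨S, hS, hcard⟩ := exists_finset_closure_eq_top p hE
  set T : Finset U := S.image fun q => q.out
  refine le_trans (Nat.pow_le_pow_right (Fact.out : p.Prime).pos ?_) hcard
  refine le_trans (Nat.sInf_le (m := T.card) ⟨T, rfl, ?_⟩) Finset.card_image_le
  -- the lifts `T` of the generators `S` of `U / V` generate `U` topologically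
  set D := Subgroup.closure (T : Set U)
  have hDmap : D.map (QuotientGroup.mk' (V.subgroupOf U)) = ⊤ := by
    rw [eq_top_iff, ← hS, Subgroup.closure_le]
    intro q hq
    refine ⟨q.out, Subgroup.subset_closure ?_, QuotientGroup.out_eq' q⟩
    exact Finset.mem_coe.2 (Finset.mem_image_of_mem _ hq)
  have hsup : U ≤ D.map U.subtype ⊔ V := by
    intro x hx
    obtain ⟨d, hd, hdx⟩ : (QuotientGroup.mk' (V.subgroupOf U) ⟨x, hx⟩) ∈
      D.map (QuotientGroup.mk' (V.subgroupOf U)) := hDmap ▸ Subgroup.mem_top _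
    have hdx : d⁻¹ * ⟨x, hx⟩ ∈ V.subgroupOf U := QuotientGroup.eq.1 hdx
    have h1 : (d : H) * ((d : H)⁻¹ * x) ∈ D.map U.subtype ⊔ V :=
      mul_mem (Subgroup.mem_sup_left (Subgroup.mem_map_of_mem U.subtype hd))
        (Subgroup.mem_sup_right hdx)
    rwa [mul_inv_cancel_left] at h1
  intro x
  rw [mem_closure_iff]
  rintro _ ⟨W, hW, rfl⟩ hxW
  obtain ⟨O, hO⟩ := ProfiniteGrp.exist_openNormalSubgroup_sub_open_nhds_of_one (G := H)
    (U := (fun y => (x : H) * y) ⁻¹' W) (hW.preimage (by fun_prop)) (by simpa using hxW)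
  have hOn : O.toSubgroup.Normal := O.isNormal'
  have hx := le_sup_of_le_sup_frattiniStep p hH (Subgroup.map_subtype_le D) hsup O.isNormal'
    O.isOpen' x.2
  rw [← SetLike.mem_coe, Subgroup.mul_normal] at hx
  obtain ⟨_, ⟨d, hd, rfl⟩, o, ho, hdo⟩ := hx
  refine ⟨d, ?_, hd⟩
  have hdo : (d : H) * o = x := hdo
  have : (d : H) = (x : H) * o⁻¹ := by rw [← hdo, mul_inv_cancel_right]
  change (d : H) ∈ W
  rw [this]
  exact hO (inv_mem ho)

/-- A bound on elementary abelian sections between open normal subgroups, coming from Schreier's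
bound on the number of generators of a subgroup of finite index. -/
theorem relIndex_le_pow (p : ℕ) [Fact p.Prime] [CompactSpace H] {S : Finset H}
    (hS : TopGenerates (S : Set H)) {U V : Subgroup H} (hUn : U.Normal) (hVn : V.Normal)
    (hVU : V ≤ U) (hV : IsOpen (V : Set H)) (hcomm : ∀ x ∈ U, ∀ y ∈ U, ⁅x, y⁆ ∈ V)
    (hpow : ∀ x ∈ U, x ^ p ∈ V) : V.relIndex U ≤ p ^ (U.index * S.card) := by
  have hp : p.Prime := Fact.out
  set Γ := Subgroup.closure (S : Set H)
  have : Group.FG Γ := (Group.fg_iff_subgroup_fg _).2 ⟨S, rfl⟩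
  have : Finite (H ⧸ U) := Subgroup.quotient_finite_of_isOpen U (Subgroup.isOpen_mono hVU hV)
  have : U.FiniteIndex := Subgroup.finiteIndex_of_finite_quotient
  -- `U ∩ Γ` is dense in `U`, hence maps onto `U / V`, and Schreier bounds its rank
  let f : U.subgroupOf Γ →* H ⧸ V :=
    (QuotientGroup.mk' V).comp (Γ.subtype.comp (U.subgroupOf Γ).subtype)
  have hcard : Nat.card f.range ≤ p ^ Group.rank (U.subgroupOf Γ) := by
    refine card_range_le_pow_rank f hp.pos (fun a b => ?_) fun a => ?_
    · rw [← commutatorElement_eq_one_iff_mul_comm, ← map_commutatorElement]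
      exact (QuotientGroup.eq_one_iff _).2 (hcomm _ a.2 _ b.2)
    · rw [← map_pow]
      exact (QuotientGroup.eq_one_iff _).2 (hpow _ a.2)
  have hrank : Group.rank (U.subgroupOf Γ) ≤ U.index * S.card := by
    refine (Subgroup.rank_le_index_mul_rank _).trans (Nat.mul_le_mul ?_ ?_)
    · exact Nat.le_of_dvd (Nat.pos_of_ne_zero Subgroup.FiniteIndex.index_ne_zero)
        (Subgroup.relIndex_dvd_index_of_normal U Γ)
    · exact Subgroup.rank_closure_finset_le_card S
  have hsub : U.map (QuotientGroup.mk' V) ≤ f.range := by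
    rintro _ ⟨u, hu, rfl⟩
    have hopen : IsOpen {x : H | u⁻¹ * x ∈ V} :=
      hV.preimage (by fun_prop : Continuous fun x : H => u⁻¹ * x)
    obtain ⟨γ, hγ, hγΓ⟩ := hS.inter_open_nonempty _ hopen ⟨u, by simp [one_mem]⟩
    have hγU : γ ∈ U := by
      have := mul_mem hu (hVU hγ)
      rwa [mul_inv_cancel_left] at this
    exact ⟨⟨⟨γ, hγΓ⟩, hγU⟩, (QuotientGroup.eq.2 hγ).symm⟩
  have : Finite (H ⧸ V) := Subgroup.quotient_finite_of_isOpen V hV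
  calc V.relIndex U = Nat.card (U.map (QuotientGroup.mk' V)) := by
        rw [← Subgroup.relIndex_ker, QuotientGroup.ker_mk']
    _ ≤ Nat.card f.range := Nat.card_mono (Set.toFinite _) hsub
    _ ≤ p ^ (U.index * S.card) := hcard.trans (Nat.pow_le_pow_right hp.pos hrank)

/-- The infimum defining the rank gradient is bounded below by `-1`, so that it is a genuine lower
bound. -/
theorem rankGradient_mul_index_le [CompactSpace H] (U : Subgroup H) (hU : IsOpen (U : Set H)) :
    rankGradient H * U.index + 1 ≤ topRank U := by
  have : Finite (H ⧸ U) := Subgroup.quotient_finite_of_isOpen U hU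
  have hpos : (0 : ℝ) < U.index := by
    exact_mod_cast Nat.pos_of_ne_zero Subgroup.index_ne_zero_of_finite
  have hbdd : BddBelow (Set.range fun U : OpenSubgroup H =>
      ((topRank (U : Subgroup H) : ℝ) - 1) / ((U : Subgroup H).index : ℝ)) := by
    refine ⟨-1, ?_⟩
    rintro _ ⟨W, rfl⟩
    have : Finite (H ⧸ (W : Subgroup H)) := Subgroup.quotient_finite_of_isOpen _ W.isOpen'
    have h1 : (1 : ℝ) ≤ (W : Subgroup H).index := by
      exact_mod_cast Nat.pos_of_ne_zero (Subgroup.index_ne_zero_of_finite (H := (W : Subgroup H)))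
    have h2 : (0 : ℝ) ≤ topRank (W : Subgroup H) := Nat.cast_nonneg _
    change -1 ≤ ((topRank (W : Subgroup H) : ℝ) - 1) / ((W : Subgroup H).index : ℝ)
    rw [le_div_iff₀ (by linarith)]
    linarith
  have h := ciInf_le hbdd (⟨U, hU⟩ : OpenSubgroup H)
  have h : rankGradient H ≤ ((topRank U : ℝ) - 1) / (U.index : ℝ) := h
  rw [le_div_iff₀ hpos] at h
  linarith

end Generation

/-! ### Growth of the Frattini series -/

section FrattiniGrowth

theorem log_index_eq_add {Γ : Type*} [Group Γ] {K L : Subgroup Γ} (hKL : K ≤ L) (hK : K.index ≠ 0) :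
    Real.log K.index = Real.log L.index + Real.log (K.relIndex L) := by
  have h := Subgroup.relIndex_mul_index hKL
  have h0 : K.relIndex L ≠ 0 ∧ L.index ≠ 0 := by
    constructor <;> intro h0 <;> simp [h0] at h <;> exact hK h.symm
  rw [← h, Nat.cast_mul, Real.log_mul (by exact_mod_cast h0.1) (by exact_mod_cast h0.2)]
  ring

theorem log_natCast_le_of_le_pow {m p e : ℕ} (hm : m ≠ 0) (h : m ≤ p ^ e) :
    Real.log m ≤ e * Real.log p := by
  rw [← Real.log_pow]
  exact Real.log_le_log (by exact_mod_cast Nat.pos_of_ne_zero hm) (by exact_mod_cast h)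

variable {H : Type*} [Group H] [TopologicalSpace H] [IsTopologicalGroup H]

theorem index_frattiniSeries_ne_zero (p : ℕ) [Fact p.Prime] [CompactSpace H] (hfg : IsTopFG H)
    (n : ℕ) : (frattiniSeries p H n).index ≠ 0 := by
  have : Finite (H ⧸ frattiniSeries p H n) :=
    Subgroup.quotient_finite_of_isOpen _ (isOpen_frattiniSeries p hfg n)
  exact Subgroup.index_ne_zero_of_finite

theorem pow_mem_frattiniSeries (p : ℕ) (x : H) (n : ℕ) : x ^ p ^ n ∈ frattiniSeries p H n := by
  induction n with
  | zero => exact Subgroup.mem_top _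
  | succ n ih =>
    rw [pow_succ, pow_mul]
    exact pow_mem_frattiniStep p ih

theorem frattiniSeries_le_comap {G : Type*} [Group G] [TopologicalSpace G] [IsTopologicalGroup G]
    (p : ℕ) (f : H →* G) (hf : Continuous f) (n : ℕ) :
    frattiniSeries p H n ≤ (frattiniSeries p G n).comap f := by
  induction n with
  | zero => exact fun _ _ => Subgroup.mem_top _
  | succ n ih =>
    refine frattiniStep_le p ((isClosed_frattiniSeries p (n + 1)).preimage hf)
      (fun x hx y hy => ?_) fun x hx => ?_
    · rw [Subgroup.mem_comap, map_commutatorElement]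
      exact commutator_mem_frattiniStep p (ih hx) (ih hy)
    · rw [Subgroup.mem_comap, map_pow]
      exact pow_mem_frattiniStep p (ih hx)

/-- Along the images of the Frattini series in the quotient by `K`, each index is at most
exponential in the preceding one. The bound is written with `exp (log _)`, in the form that the
lemmas on sequences of tower-exponential growth take. -/
theorem log_index_sup_succ_le (p : ℕ) [Fact p.Prime] [CompactSpace H] {S : Finset H}
    (hS : TopGenerates (S : Set H)) {K : Subgroup H} (hK : K.Normal) (n : ℕ) :
    Real.log (K ⊔ frattiniSeries p H (n + 1)).index ≤
      Real.log (K ⊔ frattiniSeries p H n).index +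
        S.card * Real.log p * Real.exp (Real.log (K ⊔ frattiniSeries p H n).index) := by
  have hn := frattiniSeries_normal (G := H) p n
  have hn1 := frattiniSeries_normal (G := H) p (n + 1)
  have ho := isOpen_frattiniSeries (G := H) p ⟨S, hS⟩
  set U := K ⊔ frattiniSeries p H n with hU
  set V := K ⊔ frattiniSeries p H (n + 1)
  have hVU : V ≤ U := sup_le_sup_left (frattiniSeries_antitone p (Nat.le_succ n)) K
  have hVo : IsOpen (V : Set H) := Subgroup.isOpen_mono le_sup_right (ho (n + 1))
  have : Finite (H ⧸ V) := Subgroup.quotient_finite_of_isOpen V hVo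
  have hVi : V.index ≠ 0 := Subgroup.index_ne_zero_of_finite
  have hrep : ∀ x ∈ U, ∃ a ∈ frattiniSeries p H n,
      QuotientGroup.mk' K x = QuotientGroup.mk' K a := by
    intro x hx
    rw [← SetLike.mem_coe, hU, Subgroup.normal_mul] at hx
    obtain ⟨k, hk, a, ha, rfl⟩ := hx
    refine ⟨a, ha, ?_⟩
    have hk1 : QuotientGroup.mk' K k = 1 := (QuotientGroup.eq_one_iff k).2 hk
    change QuotientGroup.mk' K (k * a) = _
    rw [map_mul, hk1, one_mul]
  have hlift : ∀ x y : H, QuotientGroup.mk' K x = QuotientGroup.mk' K y →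
      y ∈ frattiniSeries p H (n + 1) → x ∈ V := by
    intro x y hxy hy
    have h1 : y⁻¹ * x ∈ K := QuotientGroup.eq.1 hxy.symm
    have h2 : y * (y⁻¹ * x) ∈ V :=
      mul_mem (Subgroup.mem_sup_right hy) (Subgroup.mem_sup_left h1)
    rwa [mul_inv_cancel_left] at h2
  have hrel : V.relIndex U ≤ p ^ (U.index * S.card) := by
    refine relIndex_le_pow p hS inferInstance inferInstance hVU hVo (fun x hx y hy => ?_)
      fun x hx => ?_
    · obtain ⟨a, ha, hxa⟩ := hrep x hx
      obtain ⟨b, hb, hyb⟩ := hrep y hy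
      refine hlift _ ⁅a, b⁆ ?_ (commutator_mem_frattiniStep p ha hb)
      rw [map_commutatorElement, map_commutatorElement, hxa, hyb]
    · obtain ⟨a, ha, hxa⟩ := hrep x hx
      refine hlift _ (a ^ p) ?_ (pow_mem_frattiniStep p ha)
      rw [map_pow, map_pow, hxa]
  have hmul := Subgroup.relIndex_mul_index hVU
  have hr0 : V.relIndex U ≠ 0 := fun h => hVi (by rw [← hmul, h, zero_mul])
  have hU0 : U.index ≠ 0 := fun h => hVi (by rw [← hmul, h, mul_zero])
  rw [log_index_eq_add hVU hVi, Real.exp_log (by exact_mod_cast Nat.pos_of_ne_zero hU0)]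
  have := log_natCast_le_of_le_pow hr0 hrel
  push_cast at this
  linarith

theorem log_index_frattiniSeries_succ_le (p : ℕ) [Fact p.Prime] [CompactSpace H] {S : Finset H}
    (hS : TopGenerates (S : Set H)) (n : ℕ) :
    Real.log (frattiniSeries p H (n + 1)).index ≤ Real.log (frattiniSeries p H n).index +
      S.card * Real.log p * Real.exp (Real.log (frattiniSeries p H n).index) := by
  simpa using log_index_sup_succ_le p hS (K := ⊥) inferInstance n

/-- The rank gradient bounds the growth of the Frattini series from below: when it is positive, it
makes the logarithm of each index at least proportional to the preceding index. -/
theorem le_log_index_frattiniSeries_succ (p : ℕ) [Fact p.Prime] (hH : IsProP p H)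
    (hfg : IsTopFG H) (n : ℕ) :
    Real.log (frattiniSeries p H n).index + rankGradient H * Real.log p *
      Real.exp (Real.log (frattiniSeries p H n).index) ≤
        Real.log (frattiniSeries p H (n + 1)).index := by
  have := hH.compact
  have hi := index_frattiniSeries_ne_zero (H := H) p hfg
  have ho := isOpen_frattiniSeries p hfg n
  have h1 := pow_topRank_le_relIndex p hH hfg (frattiniSeries_normal p n) ho
  have h2 := rankGradient_mul_index_le _ ho
  have hp1 : (1 : ℝ) < p := by exact_mod_cast (Fact.out : p.Prime).one_lt
  have hlogp : 0 < Real.log p := Real.log_pos hp1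
  rw [log_index_eq_add (frattiniSeries_antitone p (Nat.le_succ n)) (hi (n + 1)),
    Real.exp_log (by exact_mod_cast Nat.pos_of_ne_zero (hi n))]
  have h3 : topRank (frattiniSeries p H n) * Real.log p ≤
      Real.log ((frattiniSeries p H (n + 1)).relIndex (frattiniSeries p H n)) := by
    rw [← Real.log_pow]
    exact Real.log_le_log (by positivity) (by exact_mod_cast h1)
  nlinarith

theorem infinite_of_rankGradient_pos (p : ℕ) [Fact p.Prime] (hH : IsProP p H) (hfg : IsTopFG H)
    (hrg : 0 < rankGradient H) : Infinite H := by
  have := hH.compact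
  by_contra hinf
  have hfin : Finite H := not_infinite_iff_finite.1 hinf
  have hlogp : 0 < Real.log p := Real.log_pos (by exact_mod_cast (Fact.out : p.Prime).one_lt)
  have htop := (tendsto_atTop_of_exp_growth (mul_pos hrg hlogp) (Real.log_natCast_nonneg _)
    (le_log_index_frattiniSeries_succ p hH hfg)).2
  obtain ⟨n, hn⟩ := (htop.eventually_gt_atTop (Real.log (Nat.card H))).exists
  refine absurd hn (not_lt.2 (Real.log_le_log ?_ ?_))
  · exact_mod_cast Nat.pos_of_ne_zero (index_frattiniSeries_ne_zero p hfg n)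
  · exact_mod_cast Nat.le_of_dvd Nat.card_pos (Subgroup.index_dvd_card _)

/-- If infinitely many elements are central modulo the normal subgroup `L`, then the image of
the Frattini series in the quotient by `L` grows negligibly slowly: `L` has full density. -/
theorem tendsto_log_index_sup_div (p : ℕ) [Fact p.Prime] (hH : IsProP p H) (hfg : IsTopFG H)
    (hrg : 0 < rankGradient H) {L : Subgroup H} (hL : L.Normal) {M : Set H} (hM : M.Infinite)
    (hML : ∀ m ∈ M, ∀ h, ⁅m, h⁆ ∈ L) :
    Tendsto (fun n => Real.log (L ⊔ frattiniSeries p H n).index /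
      Real.log (frattiniSeries p H n).index) atTop (𝓝 0) := by
  classical
  have := hH.compact
  have hp : p.Prime := Fact.out
  have hlogp : 0 < Real.log p := Real.log_pos (by exact_mod_cast hp.one_lt)
  obtain ⟨S₀, hS₀⟩ := id hfg
  set Φ := frattiniSeries p H
  have hΦn : ∀ n, (Φ n).Normal := frattiniSeries_normal p
  have hi : ∀ n, (Φ n).index ≠ 0 := index_frattiniSeries_ne_zero p hfg
  have hfin : ∀ n, (Φ n).FiniteIndex := fun n => ⟨hi n⟩
  have hsupi : ∀ (K : Subgroup H) n, (K ⊔ Φ n).index ≠ 0 := fun K n => by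
    have : (K ⊔ Φ n).FiniteIndex := Subgroup.finiteIndex_of_le le_sup_right
    exact Subgroup.FiniteIndex.index_ne_zero
  refine tendsto_div_of_exp_growth (ρ := rankGradient H * Real.log p)
    (d := S₀.card * Real.log p) (q := Real.log p) (by positivity) (by positivity)
    (Real.log_natCast_nonneg _) (le_log_index_frattiniSeries_succ p hH hfg)
    (fun n => Real.log_natCast_nonneg _) fun k hk => ?_
  obtain ⟨S, hSM, hSk⟩ := hM.exists_subset_card_eq k
  -- `A` is generated by `k` elements that are central modulo `L`
  set A := Subgroup.closure (S : Set H) with hA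
  set Z := (Subgroup.center (H ⧸ L)).comap (QuotientGroup.mk' L) with hZ
  have hmemZ : ∀ x, x ∈ Z ↔ ∀ h, ⁅x, h⁆ ∈ L := by
    intro x
    rw [hZ, Subgroup.mem_comap, Subgroup.mem_center_iff]
    constructor
    · intro hx h
      refine (QuotientGroup.eq_one_iff _).1 ?_
      have : QuotientGroup.mk' L ⁅x, h⁆ = 1 := by
        rw [map_commutatorElement, commutatorElement_eq_one_iff_mul_comm]
        exact (hx _).symm
      exact this
    · intro hx g
      obtain ⟨h, rfl⟩ := QuotientGroup.mk'_surjective L g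
      have : QuotientGroup.mk' L ⁅x, h⁆ = 1 := (QuotientGroup.eq_one_iff _).2 (hx h)
      rw [map_commutatorElement, commutatorElement_eq_one_iff_mul_comm] at this
      exact this.symm
  have hAZ : A ≤ Z := (Subgroup.closure_le _).2 fun s hs => (hmemZ s).2 (hML s (hSM hs))
  have hLZ : L ≤ Z := fun x hx => (hmemZ x).2 fun h =>
    by rw [commutatorElement_def, mul_assoc, mul_assoc, ← mul_assoc h]
       exact mul_mem hx (hL.conj_mem _ (inv_mem hx) h)
  set K := A ⊔ L with hK
  have hKn : K.Normal := by
    refine ⟨fun x hx h => ?_⟩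
    have h1 : ⁅x, h⁆ ∈ L := (hmemZ x).1 (sup_le hAZ hLZ hx) h
    have h2 : ⁅x, h⁆⁻¹ * x ∈ K := mul_mem (Subgroup.mem_sup_right (inv_mem h1)) hx
    rwa [commutatorElement_inv, commutatorElement_def, inv_mul_cancel_right] at h2
  refine ⟨fun n => Real.log (K ⊔ Φ n).index, log_index_sup_succ_le p hS₀ hKn, fun n => ?_, ?_,
    fun n => ?_⟩
  · exact Real.log_le_log (by exact_mod_cast Nat.pos_of_ne_zero (hsupi K n))
      (by exact_mod_cast Subgroup.index_antitone le_sup_right)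
  · -- `k ≤ |K Φ_n : Φ_n|`, as the elements of `S` are eventually distinct modulo `Φ_n`
    have hsep : ∀ᶠ n in atTop, ∀ s ∈ S, ∀ t ∈ S, s ≠ t → s⁻¹ * t ∉ Φ n := by
      refine (Finset.eventually_all S).2 fun s _ => (Finset.eventually_all S).2 fun t _ => ?_
      by_cases hst : s = t
      · simp [hst]
      obtain ⟨m, hm⟩ := (frattiniFiltration p hH hfg).exists_notMem (x := s⁻¹ * t)
        (fun h => hst (inv_mul_eq_one.1 h))
      exact eventually_atTop.2 ⟨m, fun n hn _ h => hm (frattiniSeries_antitone p hn h)⟩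
    filter_upwards [hsep] with n hn
    have : Finite (H ⧸ Φ n) := Subgroup.finite_quotient_of_finiteIndex
    have hcard : k ≤ (Φ n).relIndex (K ⊔ Φ n) := by
      rw [← QuotientGroup.ker_mk' (Φ n), Subgroup.relIndex_ker, QuotientGroup.ker_mk', ← hSk,
        ← Nat.card_eq_finsetCard]
      refine Nat.card_le_card_of_injective (fun s : S => ⟨QuotientGroup.mk' (Φ n) s,
        Subgroup.mem_map_of_mem _ (Subgroup.mem_sup_left (Subgroup.mem_sup_left
          (Subgroup.subset_closure s.2)))⟩) fun s t hst => ?_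
      by_contra hne
      exact hn s s.2 t t.2 (fun h => hne (Subtype.ext h))
        (QuotientGroup.eq.1 (Subtype.ext_iff.1 hst))
    have h1 := log_index_eq_add (K := Φ n) (L := K ⊔ Φ n) le_sup_right (hi n)
    have h2 : Real.log k ≤ Real.log ((Φ n).relIndex (K ⊔ Φ n)) :=
      Real.log_le_log (by exact_mod_cast hk) (by exact_mod_cast hcard)
    linarith
  · -- `A` is abelian of exponent dividing `p ^ n` modulo `L Φ n`
    have hle : L ⊔ Φ n ≤ K ⊔ Φ n := sup_le_sup_right le_sup_right _
    have h1 := log_index_eq_add hle (hsupi L n)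
    have hrel : (L ⊔ Φ n).relIndex (K ⊔ Φ n) ≤ p ^ (n * k) := by
      have hFG : Group.FG A := (Group.fg_iff_subgroup_fg _).2 ⟨S, rfl⟩
      have hcard := card_range_le_pow_rank
        ((QuotientGroup.mk' (L ⊔ Φ n)).comp A.subtype) (e := p ^ n) (pow_pos hp.pos n)
        (fun a b => by
          rw [← commutatorElement_eq_one_iff_mul_comm, ← map_commutatorElement]
          exact (QuotientGroup.eq_one_iff _).2
            (Subgroup.mem_sup_left ((hmemZ _).1 (hAZ a.2) _)))
        (fun a => by
          rw [← map_pow]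
          exact (QuotientGroup.eq_one_iff _).2
            (Subgroup.mem_sup_right (pow_mem_frattiniSeries p (a : H) n)))
      rw [hK, sup_assoc, Subgroup.relIndex_sup_right]
      have hker := Subgroup.relIndex_ker A (QuotientGroup.mk' (L ⊔ Φ n))
      rw [QuotientGroup.ker_mk'] at hker
      rw [MonoidHom.range_comp, Subgroup.range_subtype, ← hker, ← pow_mul] at hcard
      refine hcard.trans (Nat.pow_le_pow_right hp.pos (Nat.mul_le_mul_left n ?_))
      rw [← hSk]
      exact Subgroup.rank_closure_finset_le_card S
    have hr0 : (L ⊔ Φ n).relIndex (K ⊔ Φ n) ≠ 0 := fun h =>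
      hsupi L n (by rw [← Subgroup.relIndex_mul_index hle, h, zero_mul])
    have h2 := log_natCast_le_of_le_pow hr0 hrel
    push_cast at h2
    rw [h1]
    linarith

end FrattiniGrowth

/-! ### Normal subgroups of direct products -/

section ProductSpectrum

theorem relIndex_pi {ι : Type*} [Fintype ι] {H : ι → Type*} [∀ j, Group (H j)]
    (A B : ∀ j, Subgroup (H j)) [∀ j, (A j).Normal] :
    (Subgroup.pi Set.univ A).relIndex (Subgroup.pi Set.univ B) = ∏ j, (A j).relIndex (B j) := by
  let f : (∀ j, H j) →* ∀ j, H j ⧸ A j :=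
    MonoidHom.piMap fun j => QuotientGroup.mk' (A j)
  have hker : f.ker = Subgroup.pi Set.univ A := by
    ext x
    simp only [MonoidHom.mem_ker, Subgroup.mem_pi, Set.mem_univ, true_imp_iff, funext_iff]
    exact forall_congr' fun j => QuotientGroup.eq_one_iff _
  have hmap : ((Subgroup.pi Set.univ B).map f : Set (∀ j, H j ⧸ A j)) =
      Set.pi Set.univ fun j => ((B j).map (QuotientGroup.mk' (A j)) : Set (H j ⧸ A j)) := by
    ext y
    constructor
    · rintro ⟨x, hx, rfl⟩ j -
      exact ⟨x j, hx j (Set.mem_univ j), rfl⟩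
    · intro hy
      choose x hx hxy using fun j => hy j (Set.mem_univ j)
      exact ⟨x, fun j _ => hx j, funext hxy⟩
  have hj : ∀ j, (A j).relIndex (B j) = Nat.card ((B j).map (QuotientGroup.mk' (A j))) :=
    fun j => by rw [← Subgroup.relIndex_ker, QuotientGroup.ker_mk']
  rw [← hker, Subgroup.relIndex_ker]
  simp only [hj]
  rw [← Nat.card_pi]
  exact Nat.card_congr ((Equiv.setCongr hmap).trans (Equiv.Set.univPi _))

variable {ι : Type*} [Fintype ι] {H : ι → Type*} [∀ j, Group (H j)]

theorem index_pi (A : ∀ j, Subgroup (H j)) [∀ j, (A j).Normal] :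
    (Subgroup.pi Set.univ A).index = ∏ j, (A j).index := by
  have h := relIndex_pi A fun _ => ⊤
  simpa [Subgroup.pi_top, Subgroup.relIndex_top_right] using h

variable [∀ j, TopologicalSpace (H j)]

theorem frattiniSeries_pi [∀ j, IsTopologicalGroup (H j)] (p n : ℕ) :
    frattiniSeries p (∀ j, H j) n = Subgroup.pi Set.univ fun j => frattiniSeries p (H j) n := by
  classical
  refine le_antisymm (fun x hx j _ => ?_) fun x hx => ?_
  · exact frattiniSeries_le_comap p (Pi.evalMonoidHom H j) (continuous_apply j) n hx
  · refine Subgroup.pi_mem_of_mulSingle_mem x fun j => ?_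
    exact frattiniSeries_le_comap p (MonoidHom.mulSingle H j) (continuous_mulSingle j) n
      (hx j (Set.mem_univ j))

variable (p : ℕ) [Fact p.Prime]

/-- There are numbers `β j`, the limiting shares of the factors in `log |G : Φ_n(G)|`, such that
the Hausdorff dimension of a closed normal subgroup `N` is the sum of those `β j` for which the
projection of `N` to the `j`-th factor is infinite. -/
theorem exists_hdim_eq_sum [Nonempty ι] (hH : ∀ j, IsProP p (H j)) (hfg : ∀ j, IsTopFG (H j))
    (hrg : ∀ j, 0 < rankGradient (H j)) :
    ∃ β : ι → ℝ≥0∞, ∀ N : Subgroup (∀ j, H j), N.Normal → IsClosed (N : Set (∀ j, H j)) →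
      ∀ J : Finset ι, (∀ j, j ∈ J ↔ Infinite (N.map (Pi.evalMonoidHom H j))) →
        hdim (frattiniFiltration p (IsProP.pi p hH) (IsTopFG.pi hfg)) N = ∑ j ∈ J, β j := by
  classical
  have := fun j => (hH j).isTopologicalGroup
  have := fun j => (hH j).compact
  have hlogp : 0 < Real.log p := Real.log_pos (by exact_mod_cast (Fact.out : p.Prime).one_lt)
  choose S hS using id hfg
  set Φ := fun j n => frattiniSeries p (H j) n
  have hΦn : ∀ j n, (Φ j n).Normal := fun j n => frattiniSeries_normal p n
  have hi : ∀ j n, (Φ j n).index ≠ 0 := fun j n => index_frattiniSeries_ne_zero p (hfg j) n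
  have hfin : ∀ j n, (Φ j n).FiniteIndex := fun j n => ⟨hi j n⟩
  have hrel : ∀ j n (K : Subgroup (H j)), (Φ j n).relIndex K ≠ 0 := fun j n K =>
    Subgroup.FiniteIndex.index_ne_zero (H := (Φ j n).subgroupOf K)
  set u : ι → ℕ → ℝ := fun j n => Real.log (Φ j n).index with hu
  have hu0 : ∀ j n, 0 ≤ u j n := fun j n => Real.log_natCast_nonneg _
  have hρ : ∀ j, 0 < rankGradient (H j) * Real.log p := fun j => mul_pos (hrg j) hlogp
  have hul := fun j => le_log_index_frattiniSeries_succ p (hH j) (hfg j)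
  have htop : ∀ j, Tendsto (u j) atTop atTop := fun j =>
    (tendsto_atTop_of_exp_growth (hρ j) (hu0 j 0) (hul j)).2
  choose β hβ0 hβ using exists_tendsto_div_sum hρ
    (fun j => (by positivity : 0 ≤ (S j).card * Real.log p)) (fun j => hu0 j 0) hul
    (fun j n => log_index_frattiniSeries_succ_le p (hS j) n)
  have hUtop : Tendsto (fun n => ∑ j, u j n) atTop atTop :=
    tendsto_atTop_mono (fun n => Finset.single_le_sum (f := fun j => u j n)
      (fun j _ => hu0 j n) (Finset.mem_univ (Classical.arbitrary ι))) (htop _)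
  refine ⟨fun j => ENNReal.ofReal (β j), fun N hN hNc J hJ => ?_⟩
  rw [← ENNReal.ofReal_sum_of_nonneg fun j _ => hβ0 j]
  have hprod : ∀ n, (frattiniFiltration p (IsProP.pi p hH) (IsTopFG.pi hfg)).toFun n =
      Subgroup.pi Set.univ fun j => Φ j n := fun n => frattiniSeries_pi p n
  have hlogindex : ∀ n, Real.log
      ((frattiniFiltration p (IsProP.pi p hH) (IsTopFG.pi hfg)).toFun n).index =
        ∑ j, u j n := fun n => by
    rw [hprod, index_pi, Nat.cast_prod, Real.log_prod fun j _ => by exact_mod_cast hi j n]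
  have hlogpi : ∀ n (K : ∀ j, Subgroup (H j)),
      Real.log ((Subgroup.pi Set.univ fun j => Φ j n).relIndex (Subgroup.pi Set.univ K)) =
        ∑ j, Real.log ((Φ j n).relIndex (K j)) := fun n K => by
    rw [relIndex_pi, Nat.cast_prod, Real.log_prod fun j _ => by exact_mod_cast hrel j n _]
  refine hdim_eq_of_tendsto _ N hNc ?_ ?_
  · simpa only [hlogindex] using hUtop
  simp only [hlogindex]
  simp only [hprod]
  have hpifin : ∀ n, (Subgroup.pi Set.univ fun j => Φ j n).FiniteIndex := fun n => by
    refine ⟨?_⟩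
    rw [index_pi]
    exact Finset.prod_ne_zero_iff.2 fun j _ => hi j n
  have hpirel : ∀ n (K : Subgroup (∀ j, H j)),
      (Subgroup.pi Set.univ fun j => Φ j n).relIndex K ≠ 0 := fun n K =>
    Subgroup.FiniteIndex.index_ne_zero
      (H := (Subgroup.pi Set.univ fun j => Φ j n).subgroupOf K)
  have hmono : ∀ n (K L : Subgroup (∀ j, H j)), K ≤ L →
      Real.log ((Subgroup.pi Set.univ fun j => Φ j n).relIndex K) ≤
        Real.log ((Subgroup.pi Set.univ fun j => Φ j n).relIndex L) := fun n K L hKL =>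
    Real.log_le_log (by exact_mod_cast Nat.pos_of_ne_zero (hpirel n K))
      (by exact_mod_cast Subgroup.relIndex_le_of_le_right hKL (hpirel n L))
  -- `N` lies between the product of its intersections with the factors and the product of its
  -- projections to the factors
  set L : ∀ j, Subgroup (H j) := fun j => N.comap (MonoidHom.mulSingle H j) with hL
  set M : ∀ j, Subgroup (H j) := fun j => N.map (Pi.evalMonoidHom H j)
  have hLN : Subgroup.pi Set.univ L ≤ N := fun x hx =>
    Subgroup.pi_mem_of_mulSingle_mem x fun j => hx j (Set.mem_univ j)
  have hNM : N ≤ Subgroup.pi Set.univ M := fun x hx j _ =>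
    Subgroup.mem_map_of_mem (Pi.evalMonoidHom H j) hx
  have hML : ∀ j, ∀ m ∈ M j, ∀ h, ⁅m, h⁆ ∈ L j := by
    rintro j _ ⟨g, hg, rfl⟩ h
    have hmem : ⁅g, MonoidHom.mulSingle H j h⁆ ∈ N := by
      rw [commutatorElement_def, mul_assoc, mul_assoc, ← mul_assoc (MonoidHom.mulSingle H j h)]
      exact mul_mem hg (hN.conj_mem _ (inv_mem hg) _)
    have heq : MonoidHom.mulSingle H j ⁅g j, h⁆ = ⁅g, MonoidHom.mulSingle H j h⁆ := by
      funext i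
      by_cases hij : i = j
      · subst hij
        simp [commutatorElement_def]
      · simp [commutatorElement_def, hij]
    change MonoidHom.mulSingle H j ⁅g j, h⁆ ∈ N
    rwa [heq]
  set c : ι → ℕ → ℝ := fun j n => Real.log (L j ⊔ Φ j n).index with hc
  have hLrel : ∀ j n, Real.log ((Φ j n).relIndex (L j)) = u j n - c j n := fun j n => by
    have h := log_index_eq_add (K := Φ j n) (L := L j ⊔ Φ j n) le_sup_right (hi j n)
    rw [Subgroup.relIndex_sup_right] at h
    simp only [hu, hc]
    linarith
  have hclim : ∀ j ∈ J, Tendsto (fun n => c j n / u j n) atTop (𝓝 0) := fun j hj => by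
    have : Infinite (M j) := (hJ j).1 hj
    exact tendsto_log_index_sup_div p (hH j) (hfg j) (hrg j) inferInstance
      (Set.infinite_coe_iff.1 this) (hML j)
  have hlow : ∀ n, ∑ j ∈ J, (u j n - c j n) ≤
      Real.log ((Subgroup.pi Set.univ fun j => Φ j n).relIndex N) := fun n => by
    refine le_trans ?_ (hmono n _ _ hLN)
    rw [hlogpi]
    simp only [← hLrel]
    exact Finset.sum_le_univ_sum_of_nonneg fun j => Real.log_natCast_nonneg _
  set C := ∑ j ∈ Jᶜ, Real.log (Nat.card (M j))
  have hupp : ∀ n, Real.log ((Subgroup.pi Set.univ fun j => Φ j n).relIndex N) ≤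
      ∑ j ∈ J, u j n + C := fun n => by
    refine (hmono n _ _ hNM).trans ?_
    rw [hlogpi, ← Finset.sum_add_sum_compl J]
    refine add_le_add (Finset.sum_le_sum fun j _ => ?_) (Finset.sum_le_sum fun j hj => ?_)
    · exact Real.log_le_log (by exact_mod_cast Nat.pos_of_ne_zero (hrel j n _))
        (Nat.cast_le.2 (Nat.le_of_dvd (Nat.pos_of_ne_zero (hi j n))
          (Subgroup.relIndex_dvd_index_of_normal _ _)))
    · have hfinM : Finite (M j) := by
        rw [← not_infinite_iff_finite, ← hJ]
        exact Finset.mem_compl.1 hj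
      exact Real.log_le_log (by exact_mod_cast Nat.pos_of_ne_zero (hrel j n _))
        (Nat.cast_le.2 (Nat.le_of_dvd Nat.card_pos (Subgroup.relIndex_dvd_card _ _)))
  have hmain : Tendsto (fun n => ∑ j ∈ J, u j n / ∑ i, u i n) atTop (𝓝 (∑ j ∈ J, β j)) :=
    tendsto_finsetSum _ fun j _ => hβ j
  -- the error caused by the indices of the `L j`
  have herr : Tendsto (fun n => ∑ j ∈ J, u j n / (∑ i, u i n) * (c j n / u j n)) atTop
      (𝓝 0) := by
    have h := tendsto_finsetSum J fun j hj => (hβ j).mul (hclim j hj)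
    simpa using h
  have hlower := hmain.sub herr
  have hupper := hmain.add ((tendsto_const_nhds (x := C)).div_atTop hUtop)
  rw [sub_zero] at hlower
  rw [add_zero] at hupper
  have hpos : ∀ᶠ n in atTop, ∀ j, 0 < u j n :=
    eventually_all.2 fun j => (htop j).eventually_gt_atTop 0
  refine tendsto_of_tendsto_of_tendsto_of_le_of_le' hlower hupper ?_ ?_
  · filter_upwards [hpos, hUtop.eventually_gt_atTop 0] with n hn hUn
    rw [← Finset.sum_sub_distrib, le_div_iff₀ hUn, Finset.sum_mul]
    refine le_trans (le_of_eq (Finset.sum_congr rfl fun j _ => ?_)) (hlow n)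
    have := (hn j).ne'
    field_simp
  · filter_upwards [hUtop.eventually_gt_atTop 0] with n hUn
    rw [← Finset.sum_div, ← add_div]
    exact div_le_div_of_nonneg_right (hupp n) hUn.le

end ProductSpectrum

end ProP

theorem theorem1p7 (p : ℕ) [Fact p.Prime] (r : ℕ) (hr : 1 ≤ r) (H : Fin r → Type*)
    [∀ j, Group (H j)] [∀ j, TopologicalSpace (H j)]
    (hH : ∀ j, ProP.IsProP p (H j)) (hfg : ∀ j, ProP.IsTopFG (H j))
    (hrg : ∀ j, 0 < ProP.rankGradient (H j)) :
    ProP.normalHausdorffSpectrum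
        (ProP.frattiniFiltration p (ProP.IsProP.pi p hH) (ProP.IsTopFG.pi hfg)) =
      {d | ∃ J : Finset (Fin r), d = ∑ j ∈ J,
        ProP.hdim (ProP.frattiniFiltration p (ProP.IsProP.pi p hH) (ProP.IsTopFG.pi hfg))
          (MonoidHom.mulSingle H j).range} := by
  classical
  have : Nonempty (Fin r) := ⟨⟨0, hr⟩⟩
  have := fun j => (hH j).isTopologicalGroup
  have := fun j => (hH j).t2
  have hinf := fun j => ProP.infinite_of_rankGradient_pos p (hH j) (hfg j) (hrg j)
  obtain ⟨β, hβ⟩ := ProP.exists_hdim_eq_sum p hH hfg hrg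
  -- the product of the factors indexed by `J` has infinite projections exactly to these
  have hprod : ∀ J : Finset (Fin r), ∃ N : Subgroup (∀ j, H j), N.Normal ∧
      IsClosed (N : Set (∀ j, H j)) ∧ (∀ x, x ∈ N ↔ ∀ j ∉ J, x j = 1) ∧
      ProP.hdim (ProP.frattiniFiltration p (ProP.IsProP.pi p hH) (ProP.IsTopFG.pi hfg)) N =
        ∑ j ∈ J, β j := by
    intro J
    let N : Subgroup (∀ j, H j) := Subgroup.pi (J : Set (Fin r))ᶜ fun _ => ⊥
    have hmem : ∀ x, x ∈ N ↔ ∀ j ∉ J, x j = 1 := fun x => by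
      simp [N, Subgroup.mem_pi]
    have hNn : N.Normal := ⟨fun x hx g => (hmem _).2 fun j hj => by
      simp [(hmem x).1 hx j hj]⟩
    have hNc : IsClosed (N : Set (∀ j, H j)) := by
      have : (N : Set (∀ j, H j)) = ⋂ j ∈ (J : Set (Fin r))ᶜ, {x | x j = 1} := by
        ext x
        simp [hmem]
      rw [this]
      exact isClosed_biInter fun j _ => isClosed_eq (continuous_apply j) continuous_const
    refine ⟨N, hNn, hNc, hmem, hβ N hNn hNc J fun j => ?_⟩
    by_cases hj : j ∈ J
    · refine ⟨fun _ => ?_, fun _ => hj⟩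
      have htop : N.map (Pi.evalMonoidHom H j) = ⊤ := by
        refine eq_top_iff.2 fun x _ => ⟨Pi.mulSingle j x, (hmem _).2 fun i hi => ?_, by simp⟩
        exact Pi.mulSingle_eq_of_ne (by rintro rfl; exact hi hj) x
      rw [htop]
      exact Subgroup.topEquiv.symm.toEquiv.infinite_iff.1 (hinf j)
    · refine ⟨fun h => absurd h hj, fun h => ?_⟩
      have hbot : N.map (Pi.evalMonoidHom H j) = ⊥ := by
        rw [eq_bot_iff]
        rintro _ ⟨x, hx, rfl⟩
        exact Subgroup.mem_bot.2 ((hmem x).1 hx j hj)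
      rw [hbot] at h
      exact absurd h (not_infinite_iff_finite.2 inferInstance)
  have hfactor : ∀ j, ProP.hdim (ProP.frattiniFiltration p (ProP.IsProP.pi p hH)
      (ProP.IsTopFG.pi hfg)) (MonoidHom.mulSingle H j).range = β j := by
    intro j
    obtain ⟨N, -, -, hmem, hN⟩ := hprod {j}
    have heq : (MonoidHom.mulSingle H j).range = N := by
      ext x
      rw [hmem]
      constructor
      · rintro ⟨y, rfl⟩ i hi
        exact Pi.mulSingle_eq_of_ne (by simpa using hi) y
      · intro hx
        refine ⟨x j, funext fun i => ?_⟩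
        by_cases hij : i = j
        · subst hij
          simp
        · simp [hij, hx i (by simpa using hij)]
    rw [heq, hN, Finset.sum_singleton]
  ext d
  simp only [ProP.normalHausdorffSpectrum, Set.mem_ofPred_eq, hfactor]
  constructor
  · rintro ⟨N, hNn, hNc, rfl⟩
    exact ⟨Finset.univ.filter fun j => Infinite (N.map (Pi.evalMonoidHom H j)),
      hβ N hNn hNc _ fun j => by simp⟩
  · rintro ⟨J, rfl⟩
    obtain ⟨N, hNn, hNc, -, hN⟩ := hprod J
    exact ⟨N, hNn, hNc, hN⟩
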